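/- Let $\mathbf{Man}$ be the category of smooth manifolds (finite-dimensional, without boundary, Hausdorff, second countable) and smooth maps. A prestack is a pseudo-functor $X:\mathbf{Man}^{\mathrm{op}}\to\mathbf{Cat}$; it is a stack if for every manifold $U$ and every open cover $\{U_\alpha\subseteq U\}$ the canonical functor from $X(U)$ to the category of descent data of $X$ for $\{U_\alpha\subseteq U\}$ is an equivalence of categories. (A descent datum consists of objects $x_\alpha\in X(U_\alpha)$ and isomorphisms between the restrictions of $x_\alpha$ and $x_\beta$ to the overlaps $U_{\alpha\beta}=U_\alpha\cap U_\beta$, which are the identity for $\alpha=\beta$ and satisfy the cocycle condition on triple overlaps; a morphism is a family of morphisms $x_\alpha\to x'_\alpha$ compatible with these isomorphisms.) For a manifold $U$ let $C^\infty_{\mathbb C,U}$ be the sheaf of smooth complex-valued functions on $U$, and let $\mathbf{Sh}_{C^\infty_{\mathbb C}}(U)$ be the category of sheaves of $C^\infty_{\mathbb C,U}$-modules, with its relative tensor product $\otimes$ and with the conjugation functor $V\mapsto\overline V$ (same sheaf of abelian groups, functions acting through their complex conjugates; so $\overline{\overline V}=V$). For a smooth map $h:U\to U'$ let $h^*V=h^{-1}V\otimes_{h^{-1}C^\infty_{\mathbb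 C,U'}}C^\infty_{\mathbb C,U}$ be the pullback of sheaves of modules, i.e. the left adjoint of the pushforward $h_*$. The prestack $\mathbf{IPVec}^\infty_{\mathbb C}$ is defined as follows. * The objects of $\mathbf{IPVec}^\infty_{\mathbb C}(U)$ are triples $(V,*,\langle\cdot,\cdot\rangle)$ of a sheaf of modules $V\in\mathbf{Sh}_{C^\infty_{\mathbb C}}(U)$, a morphism $*:V\to\overline V$ with $\overline{*}\circ *=\mathrm{id}_V$, and a morphism $\langle\cdot,\cdot\rangle:V\otimes V\to C^\infty_{\mathbb C,U}$ that is symmetric, i.e. invariant under the flip of $V\otimes V$, and $*$-compatible, i.e. the composite of $*\otimes *:V\otimes V\to\overline V\otimes\overline V\cong\overline{V\otimes V}$ with $\overline{\langle\cdot,\cdot\rangle}$ equals the composite of $\langle\cdot,\cdot\rangle$ with complex conjugation $C^\infty_{\mathbb C,U}\to\overline{C^\infty_{\mathbb C,U}}$; on sections, $\langle v,v'\rangle^*=\langle v^*,v'^*\rangle$. * The morphisms $(V,*,\langle\cdot,\cdot\rangle)\to(V',*',\langle\cdot,\cdot\rangle')$ are the morphisms $\psi:V\to V'$ of sheaves of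 modules with $*'\circ\psi=\overline\psi\circ *$ and $\langle\cdot,\cdot\rangle'\circ(\psi\otimes\psi)=\langle\cdot,\cdot\rangle$. * To a smooth map $h:U\to U'$ it assigns the functor $h^*$ that sends $(V,*,\langle\cdot,\cdot\rangle)$ to $h^*V$ with the $*$-structure $h^*V\to h^*\overline V\cong\overline{h^*V}$ given by $h^*(*)$ and with the pairing $h^*V\otimes h^*V\cong h^*(V\otimes V)\to h^*C^\infty_{\mathbb C,U'}\cong C^\infty_{\mathbb C,U}$ given by $h^*\langle\cdot,\cdot\rangle$, and sends $\psi$ to $h^*\psi$. The coherence isomorphisms $\mathrm{id}^*\cong\mathrm{id}$ and $h^*h'^*\cong(h'h)^*$ are the canonical ones of pullbacks of sheaves of modules. Then the prestack $\mathbf{IPVec}^\infty_{\mathbb C}:\mathbf{Man}^{\mathrm{op}}\to\mathbf{Cat}$ is a stack. -/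

import Mathlib

open CategoryTheory TopologicalSpace Opposite
open scoped Manifold ContDiff

/-- Smooth manifolds without boundary: finite dimensional, Hausdorff and second countable. -/
structure Man : Type 1 where
  carrier : Type
  dim : ℕ
  [top : TopologicalSpace carrier]
  [charted : ChartedSpace (EuclideanSpace ℝ (Fin dim)) carrier]
  [smooth : IsManifold (𝓡 dim) ∞ carrier]
  [t2 : T2Space carrier]
  [secondCountable : SecondCountableTopology carrier]

noncomputable section
namespace Man
attribute [instance] top charted smooth t2 secondCountable

/-- The category of manifolds and smooth maps. -/
instance : Category Man where
  Hom U U' := C^∞⟮𝓡 U.dim, U.carrier; 𝓡 U'.dim, U'.carrier⟯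
  id U := ContMDiffMap.id
  comp f g := ContMDiffMap.comp g f

variable {U U' U'' : Man}

/-- The underlying topological space. -/
def toTop (U : Man) : TopCat.{0} := TopCat.of U.carrier

/-- The underlying continuous map. -/
def toTopHom (h : U ⟶ U') : U.toTop ⟶ U'.toTop :=
  TopCat.ofHom ⟨h.1, h.2.continuous⟩

instance : ContMDiffRing 𝓘(ℝ, ℂ) ∞ ℂ where
  contMDiff_add := contDiff_add.contMDiff.comp (by exact contMDiff_fst.prodMk_space contMDiff_snd)
  contMDiff_mul := (contDiff_mul (𝔸 := ℂ)).contMDiff.comp (by exact contMDiff_fst.prodMk_space contMDiff_snd)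

/-- The sheaf of rings of smooth complex valued functions. -/
def smoothFun (U : Man) : Sheaf (Opens.grothendieckTopology U.toTop) CommRingCat.{0} :=
  smoothSheafCommRing (𝓡 U.dim) 𝓘(ℝ, ℂ) U.carrier ℂ

/-- Precomposition with a smooth map, as a morphism of sheaves of rings. -/
def smoothFunHom (h : U ⟶ U') :
    U'.smoothFun ⟶ ((Opens.map (toTopHom h)).sheafPushforwardContinuous _ _ _).obj U.smoothFun :=
  ContMDiff.smoothSheafCommRingHom (R := ℂ) (𝓡 U'.dim) U'.carrier h.1 h.2

/-- The sheaf of smooth complex valued functions as a sheaf of not necessarily commutative rings. -/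
abbrev ringSheaf (U : Man) : Sheaf (Opens.grothendieckTopology U.toTop) RingCat.{0} :=
  (sheafCompose _ (forget₂ CommRingCat RingCat)).obj U.smoothFun

/-- Precomposition with a smooth map. -/
def ringSheafHom (h : U ⟶ U') :
    U'.ringSheaf ⟶ ((Opens.map (toTopHom h)).sheafPushforwardContinuous _ _ _).obj U.ringSheaf where
  hom := Functor.whiskerRight (smoothFunHom h).hom _

/-- The category of sheaves of modules over the sheaf of smooth complex valued functions. -/
def Sh (U : Man) := SheafOfModules.{0} U.ringSheaf
instance : Category (Sh U) := inferInstanceAs (Category (SheafOfModules.{0} U.ringSheaf))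

/-- The pushforward of sheaves of modules. -/
def pushforward (h : U ⟶ U') : Sh U ⥤ Sh U' := SheafOfModules.pushforward (ringSheafHom h)

instance (h : U ⟶ U') : (PresheafOfModules.pushforward.{0} (ringSheafHom h).hom).IsRightAdjoint := PresheafOfModules.instIsRightAdjointPushforward (F := Opens.map (toTopHom h)) (R := U.ringSheaf.obj) (S := U'.ringSheaf.obj) (ringSheafHom h).hom
instance (h : U ⟶ U') : (SheafOfModules.pushforward.{0} (ringSheafHom h)).IsRightAdjoint := (SheafOfModules.PullbackConstruction.adjunction.{0} (F := Opens.map (toTopHom h)) (ringSheafHom h)).isRightAdjoint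
/-- The pullback of sheaves of modules along a smooth map `h`, the left adjoint of the pushforward:
`h⁻¹ V ⊗ C^∞_U` over `h⁻¹ C^∞_{U'}`. -/
def pullback (h : U ⟶ U') : Sh U' ⥤ Sh U := SheafOfModules.pullback.{0} (ringSheafHom h)
/-- Pullback is left adjoint to pushforward. -/
def adj (h : U ⟶ U') : pullback h ⊣ pushforward h := SheafOfModules.pullbackPushforwardAdjunction (ringSheafHom h)

/-! sections -/

/-- The ring of smooth complex functions on `Ω`. -/
abbrev Fun (U : Man) (Ω : Opens U.toTop) : Type := U.smoothFun.obj.obj (op Ω)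

/-- Restriction of smooth functions. -/
def resF {U : Man} {Ω Ω' : Opens U.toTop} (i : Ω' ≤ Ω) : U.Fun Ω →+* U.Fun Ω' :=
  (U.smoothFun.obj.map (homOfLE i).op).hom

/-- Precomposition of smooth functions with a smooth map. -/
def comapF (h : U ⟶ U') (Ω : Opens U'.toTop) :
    U'.Fun Ω →+* U.Fun ((Opens.map (toTopHom h)).obj Ω) :=
  ((smoothFunHom h).hom.app (op Ω)).hom

/-- Sections over an open subset of a sheaf of modules. -/
def Sec (V : Sh U) (Ω : Opens U.toTop) : Type := SheafOfModules.val V |>.obj (op Ω)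

instance (V : Sh U) (Ω : Opens U.toTop) : AddCommGroup (Sec V Ω) :=
  inferInstanceAs (AddCommGroup ((SheafOfModules.val V).obj (op Ω)))

instance (V : Sh U) (Ω : Opens U.toTop) : Module (U.Fun Ω) (Sec V Ω) :=
  ((SheafOfModules.val V).obj (op Ω)).isModule

/-- Restriction of sections. -/
def res (V : Sh U) {Ω Ω' : Opens U.toTop} (i : Ω' ≤ Ω) : Sec V Ω →+ Sec V Ω' :=
  AddMonoidHom.mk' ((SheafOfModules.val V).map (homOfLE i).op).hom
    (map_add ((SheafOfModules.val V).map (homOfLE i).op).hom)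

lemma res_smul (V : Sh U) {Ω Ω' : Opens U.toTop} (i : Ω' ≤ Ω) (a : U.Fun Ω) (v : Sec V Ω) :
    res V i (a • v) = resF i a • res V i v :=
  (SheafOfModules.val V).map_smul (homOfLE i).op a v

@[simp] lemma res_res (V : Sh U) {Ω Ω' Ω'' : Opens U.toTop} (i : Ω' ≤ Ω) (j : Ω'' ≤ Ω')
    (v : Sec V Ω) : res V j (res V i v) = res V (j.trans i) v :=
  ((SheafOfModules.val V).map_comp_apply (homOfLE i).op (homOfLE j).op v).symm

@[simp] lemma res_refl (V : Sh U) {Ω : Opens U.toTop} (i : Ω ≤ Ω) (v : Sec V Ω) :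
    res V i v = v :=
  CategoryTheory.congr_fun ((SheafOfModules.val V).presheaf.map_id (op Ω)) v

/-- The action of a morphism of sheaves on sections. -/
def app {V W : Sh U} (f : V ⟶ W) (Ω : Opens U.toTop) : Sec V Ω →ₗ[U.Fun Ω] Sec W Ω where
  toFun := ((SheafOfModules.Hom.val f).app (op Ω)).hom
  map_add' := map_add ((SheafOfModules.Hom.val f).app (op Ω)).hom
  map_smul' := ((SheafOfModules.Hom.val f).app (op Ω)).hom.map_smul

lemma app_res {V W : Sh U} (f : V ⟶ W) {Ω Ω' : Opens U.toTop} (i : Ω' ≤ Ω) (v : Sec V Ω) :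
    app f Ω' (res V i v) = res W i (app f Ω v) :=
  PresheafOfModules.naturality_apply (SheafOfModules.Hom.val f) (homOfLE i).op v

@[simp] lemma app_id (V : Sh U) (Ω : Opens U.toTop) (v : Sec V Ω) : app (𝟙 V) Ω v = v := rfl

@[simp] lemma app_comp {V W X : Sh U} (f : V ⟶ W) (g : W ⟶ X) (Ω : Opens U.toTop) (v : Sec V Ω) :
    app (f ≫ g) Ω v = app g Ω (app f Ω v) := rfl

lemma hom_ext {V W : Sh U} {f g : V ⟶ W} (h : ∀ Ω v, app f Ω v = app g Ω v) : f = g := by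
  apply SheafOfModules.hom_ext
  ext X v
  exact h X.unop v

/-- Construction of a morphism from its action on sections. -/
def mkHom {V W : Sh U} (f : ∀ Ω, Sec V Ω → Sec W Ω) (add : ∀ Ω v v', f Ω (v + v') = f Ω v + f Ω v')
    (smul : ∀ Ω (a : U.Fun Ω) v, f Ω (a • v) = a • f Ω v)
    (nat : ∀ Ω Ω' (i : Ω' ≤ Ω) v, f Ω' (res V i v) = res W i (f Ω v)) : V ⟶ W :=
  SheafOfModules.Hom.mk
    { app X := ModuleCat.ofHom (X := (SheafOfModules.val V).obj X) (Y := (SheafOfModules.val W).obj X)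
        { toFun := f X.unop
          map_add' := add X.unop
          map_smul' := smul X.unop }
      naturality {X Y} g := by
        ext v
        exact nat X.unop Y.unop g.unop.le v }

@[simp] lemma app_mkHom {V W : Sh U} (f : ∀ Ω, Sec V Ω → Sec W Ω) (add smul nat) (Ω v) :
    app (mkHom (V := V) (W := W) f add smul nat) Ω v = f Ω v := rfl

/-- The sheaf of smooth complex functions as a module over itself. -/
def unit (U : Man) : Sh U := SheafOfModules.unit U.ringSheaf

/-- Intersection with a fixed open subset. -/
def capFun (Y : Opens U.toTop) : Opens U.toTop ⥤ Opens U.toTop where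
  obj X := X ⊓ Y
  map f := homOfLE (inf_le_inf_right Y f.le)

instance (Y : Opens U.toTop) : (capFun Y).IsContinuous (Opens.grothendieckTopology U.toTop)
    (Opens.grothendieckTopology U.toTop) := by
  apply Functor.isContinuous_of_coverPreserving
  · constructor
    intro ℱ Z T x hx Y₁ Y₂ X f₁ f₂ g₁ g₂ hg₁ hg₂ _
    have h := hx (homOfLE (inf_le_left : Y₁ ⊓ Y₂ ≤ Y₁)) (homOfLE inf_le_right) hg₁ hg₂
      (Subsingleton.elim _ _)
    let k : X ⟶ (capFun Y).obj (Y₁ ⊓ Y₂) := homOfLE (le_inf (le_inf (f₁.le.trans inf_le_left)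
      (f₂.le.trans inf_le_left)) (f₁.le.trans inf_le_right))
    have h' := congrArg (ℱ.obj.map k.op) h
    dsimp at h'
    simp only [← Functor.map_comp_apply, ← op_comp] at h'
    exact h'
  · constructor
    rintro Z S hS x ⟨hx, hxY⟩
    obtain ⟨V, i, hi, hxV⟩ := hS x hx
    exact ⟨_, (capFun Y).map i, ⟨V, i, 𝟙 _, hi, Subsingleton.elim _ _⟩, ⟨hxV, hxY⟩⟩

/-- Restriction of functions to the intersection with a fixed open subset. -/
def capRing (Y : Opens U.toTop) : U.ringSheaf ⟶
    ((capFun Y).sheafPushforwardContinuous _ (Opens.grothendieckTopology U.toTop)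
      (Opens.grothendieckTopology U.toTop)).obj U.ringSheaf where
  hom :=
    { app _ := U.ringSheaf.obj.map (homOfLE inf_le_left).op
      naturality _ _ _ := (U.ringSheaf.obj.map_comp _ _).symm.trans (U.ringSheaf.obj.map_comp _ _) }

/-- The sheaf whose sections over `X` are the sections of `N` over `X ⊓ Y`. -/
def cap (N : Sh U) (Y : Opens U.toTop) : Sh U :=
  (SheafOfModules.pushforward.{0} (capRing Y)).obj N

/-- A section of `N` over `X ⊓ Y` as section of `cap N Y` over `X`. -/
def toCap (N : Sh U) (Y X : Opens U.toTop) : Sec N (X ⊓ Y) ≃+ Sec (cap N Y) X := AddEquiv.refl _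

lemma toCap_smul (N : Sh U) (Y X : Opens U.toTop) (a : U.Fun X) (s : Sec N (X ⊓ Y)) :
    toCap N Y X (resF (inf_le_left : X ⊓ Y ≤ X) a • s) = a • toCap N Y X s := rfl

lemma res_toCap (N : Sh U) (Y : Opens U.toTop) {X X' : Opens U.toTop} (i : X' ≤ X)
    (s : Sec N (X ⊓ Y)) :
    res (cap N Y) i (toCap N Y X s) = toCap N Y X' (res N (inf_le_inf_right Y i) s) := rfl

/-- The section of the pushforward given by a section over the preimage. -/
def toPf (h : U ⟶ U') (V : Sh U) (Ω : Opens U'.toTop) :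
    Sec V ((Opens.map (toTopHom h)).obj Ω) ≃+ Sec ((pushforward h).obj V) Ω := AddEquiv.refl _

/-- The preimage of an open subset. -/
abbrev pre (h : U ⟶ U') (Ω : Opens U'.toTop) : Opens U.toTop := (Opens.map (toTopHom h)).obj Ω

lemma pre_mono (h : U ⟶ U') {Ω Ω' : Opens U'.toTop} (i : Ω' ≤ Ω) : pre h Ω' ≤ pre h Ω :=
  fun _ hx => i hx

lemma toPf_smul (h : U ⟶ U') (V : Sh U) (Ω : Opens U'.toTop) (a : U'.Fun Ω)
    (v : Sec V (pre h Ω)) : toPf h V Ω (comapF h Ω a • v) = a • toPf h V Ω v := rfl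

lemma res_toPf (h : U ⟶ U') (V : Sh U) {Ω Ω' : Opens U'.toTop} (i : Ω' ≤ Ω)
    (v : Sec V (pre h Ω)) :
    res ((pushforward h).obj V) i (toPf h V Ω v) = toPf h V Ω' (res V (pre_mono h i) v) := rfl

lemma toPf_symm_smul (h : U ⟶ U') (V : Sh U) (Ω : Opens U'.toTop) (a : U'.Fun Ω)
    (v : Sec ((pushforward h).obj V) Ω) :
    (toPf h V Ω).symm (a • v) = comapF h Ω a • (toPf h V Ω).symm v := rfl

lemma res_toPf_symm (h : U ⟶ U') (V : Sh U) {Ω Ω' : Opens U'.toTop} (i : Ω' ≤ Ω)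
    (v : Sec ((pushforward h).obj V) Ω) :
    res V (pre_mono h i) ((toPf h V Ω).symm v) =
      (toPf h V Ω').symm (res ((pushforward h).obj V) i v) := rfl

/-- The unit of the adjunction. -/
def etaHom (h : U ⟶ U') (V : Sh U') : V ⟶ (pushforward h).obj ((pullback h).obj V) :=
  (adj h).unit.app V

/-- The pullback of a section. -/
def eta (h : U ⟶ U') {V : Sh U'} {Ω : Opens U'.toTop} (v : Sec V Ω) :
    Sec ((pullback h).obj V) (pre h Ω) :=
  (toPf h _ Ω).symm (app (etaHom h V) Ω v)

section
variable (h : U ⟶ U') {V : Sh U'} {Ω : Opens U'.toTop}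

lemma eta_add (v v' : Sec V Ω) : eta h (v + v') = eta h v + eta h v' := by
  simp [eta]

lemma eta_smul (a : U'.Fun Ω) (v : Sec V Ω) : eta h (a • v) = comapF h Ω a • eta h v := by
  apply (toPf h _ Ω).injective
  simp [eta, toPf_smul]

lemma res_eta {Ω' : Opens U'.toTop} (i : Ω' ≤ Ω) (v : Sec V Ω) :
    res _ (pre_mono h i) (eta h v) = eta h (res V i v) := by
  rw [eta, eta, app_res, ← res_toPf_symm]

/-- The linear extension to the pullback of a map to a pushforward. -/
def extend {N : Sh U} (f : V ⟶ (pushforward h).obj N) : (pullback h).obj V ⟶ N :=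
  ((adj h).homEquiv _ _).symm f

@[simp] lemma extend_eta {N : Sh U} (f : V ⟶ (pushforward h).obj N) (v : Sec V Ω) :
    app (extend h f) _ (eta h v) = (toPf h N Ω).symm (app f Ω v) := by
  conv_rhs => rw [← ((adj h).homEquiv _ _).apply_symm_apply f, Adjunction.homEquiv_unit]
  rfl

lemma pullback_ext {N : Sh U} {f g : (pullback h).obj V ⟶ N}
    (H : ∀ Ω (v : Sec V Ω), app f _ (eta h v) = app g _ (eta h v)) : f = g := by
  apply ((adj h).homEquiv _ _).injective
  apply hom_ext
  intro Ω v
  rw [Adjunction.homEquiv_unit, Adjunction.homEquiv_unit]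
  exact H Ω v

@[simp] lemma pullback_map_eta {V' : Sh U'} (f : V ⟶ V') (v : Sec V Ω) :
    app ((pullback h).map f) _ (eta h v) = eta h (app f Ω v) := by
  exact (DFunLike.congr_fun (congrArg (fun k => app k Ω) ((adj h).unit.naturality f)) v).symm

end

@[simp] lemma resF_resF {Ω Ω' Ω'' : Opens U.toTop} (i : Ω' ≤ Ω) (j : Ω'' ≤ Ω') (a : U.Fun Ω) :
    resF j (resF i a) = resF (j.trans i) a := rfl

@[simp] lemma resF_refl {Ω : Opens U.toTop} (i : Ω ≤ Ω) (a : U.Fun Ω) : resF i a = a := rfl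

lemma resF_comapF (h : U ⟶ U') {Ω Ω' : Opens U'.toTop} (i : Ω' ≤ Ω) (a : U'.Fun Ω) :
    resF (pre_mono h i) (comapF h Ω a) = comapF h Ω' (resF i a) := rfl

/-- Multiplication by a function on `Y`. -/
def capSmul (N : Sh U) {Y : Opens U.toTop} (a : U.Fun Y) : cap N Y ⟶ cap N Y :=
  mkHom (fun X s => toCap N Y X (resF (inf_le_right : X ⊓ Y ≤ Y) a • (toCap N Y X).symm s))
    (fun X s s' => by simp)
    (fun X b s => by
      obtain ⟨s, rfl⟩ := (toCap N Y X).surjective s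
      rw [← toCap_smul, ← toCap_smul, AddEquiv.symm_apply_apply, AddEquiv.symm_apply_apply,
        smul_comm])
    (fun X X' i s => by
      obtain ⟨s, rfl⟩ := (toCap N Y X).surjective s
      simp [res_toCap, res_smul])

lemma capSmul_toCap (N : Sh U) {Y : Opens U.toTop} (a : U.Fun Y) (X) (s : Sec N (X ⊓ Y)) :
    app (capSmul N a) X (toCap N Y X s) =
      toCap N Y X (resF (inf_le_right : X ⊓ Y ≤ Y) a • s) := rfl

/-- Restriction from `Y` to `Y'`. -/
def capRes (N : Sh U) {Y Y' : Opens U.toTop} (j : Y' ≤ Y) : cap N Y ⟶ cap N Y' :=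
  mkHom (fun X s => toCap N Y' X (res N (inf_le_inf_left X j) ((toCap N Y X).symm s)))
    (fun X s s' => by simp)
    (fun X b s => by
      obtain ⟨s, rfl⟩ := (toCap N Y X).surjective s
      rw [← toCap_smul, ← toCap_smul, AddEquiv.symm_apply_apply, AddEquiv.symm_apply_apply,
        res_smul]
      rfl)
    (fun X X' i s => by
      obtain ⟨s, rfl⟩ := (toCap N Y X).surjective s
      simp [res_toCap])

lemma capRes_toCap (N : Sh U) {Y Y' : Opens U.toTop} (j : Y' ≤ Y) (X) (s : Sec N (X ⊓ Y)) :
    app (capRes N j) X (toCap N Y X s) = toCap N Y' X (res N (inf_le_inf_left X j) s) := rfl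

/-- The sum of two morphisms. -/
def addHom {V W : Sh U} (f g : V ⟶ W) : V ⟶ W :=
  mkHom (fun Ω v => app f Ω v + app g Ω v) (fun Ω v v' => by simp; abel) (fun Ω a v => by simp)
    (fun Ω Ω' i v => by simp [app_res])

lemma app_addHom {V W : Sh U} (f g : V ⟶ W) (Ω) (v : Sec V Ω) :
    app (addHom f g) Ω v = app f Ω v + app g Ω v := rfl

lemma pre_inf (h : U ⟶ U') (Ω Ω' : Opens U'.toTop) : pre h Ω ⊓ pre h Ω' ≤ pre h (Ω ⊓ Ω') := le_rfl

/-- A bilinear map `V × W → N` of sheaves of modules. -/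
@[ext] structure Bil (V W N : Sh U) where
  toFun : ∀ Ω : Opens U.toTop, Sec V Ω → Sec W Ω → Sec N Ω
  add_left : ∀ Ω v v' w, toFun Ω (v + v') w = toFun Ω v w + toFun Ω v' w
  add_right : ∀ Ω v w w', toFun Ω v (w + w') = toFun Ω v w + toFun Ω v w'
  smul_left : ∀ Ω (a : U.Fun Ω) v w, toFun Ω (a • v) w = a • toFun Ω v w
  smul_right : ∀ Ω (a : U.Fun Ω) v w, toFun Ω v (a • w) = a • toFun Ω v w
  res_fun : ∀ Ω Ω' (i : Ω' ≤ Ω) v w, res N i (toFun Ω v w) = toFun Ω' (res V i v) (res W i w)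

namespace Bil
variable {V W N : Sh U}

/-- Fixing the first variable to be a section over `X`. -/
def left (B : Bil V W N) {X : Opens U.toTop} (x : Sec V X) : W ⟶ cap N X :=
  mkHom (fun Z w => toCap N X Z (B.toFun (Z ⊓ X) (res V inf_le_right x) (res W inf_le_left w)))
    (fun Z w w' => by simp [B.add_right])
    (fun Z a w => by rw [← toCap_smul, res_smul, B.smul_right])
    (fun Z Z' i w => by simp [res_toCap, B.res_fun])

/-- Fixing the second variable to be a section over `X`. -/
def right (B : Bil V W N) {X : Opens U.toTop} (x : Sec W X) : V ⟶ cap N X :=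
  mkHom (fun Z v => toCap N X Z (B.toFun (Z ⊓ X) (res V inf_le_left v) (res W inf_le_right x)))
    (fun Z w w' => by simp [B.add_left])
    (fun Z a w => by rw [← toCap_smul, res_smul, B.smul_left])
    (fun Z Z' i w => by simp [res_toCap, B.res_fun])

lemma ext_of_eta (h : U ⟶ U') {V W : Sh U'} {N : Sh U}
    {B B' : Bil ((pullback h).obj V) ((pullback h).obj W) N}
    (H : ∀ Ω (v : Sec V Ω) (w : Sec W Ω),
      B.toFun (pre h Ω) (eta h v) (eta h w) = B'.toFun (pre h Ω) (eta h v) (eta h w)) : B = B' := by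
  have H1 : ∀ Ω (w : Sec W Ω), B.right (eta h w) = B'.right (eta h w) := by
    intro Ω w
    refine pullback_ext h fun Ω' v => ?_
    apply (toCap N _ _).symm.injective
    have e : ∀ (B : Bil ((pullback h).obj V) ((pullback h).obj W) N),
        (toCap N _ _).symm (app (B.right (eta h w)) (pre h Ω') (eta h v)) =
        B.toFun (pre h (Ω' ⊓ Ω)) (eta h (res V inf_le_left v)) (eta h (res W inf_le_right w)) := by
      intro B
      rw [← res_eta, ← res_eta]
      rfl
    rw [e, e, H]
  have H2 : ∀ X (x : Sec ((pullback h).obj V) X), B.left x = B'.left x := by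
    intro X x
    refine pullback_ext h fun Ω w => ?_
    apply (toCap N _ _).symm.injective
    have e : ∀ (B : Bil ((pullback h).obj V) ((pullback h).obj W) N),
        (toCap N _ _).symm (app (B.left x) (pre h Ω) (eta h w)) =
        res N (le_of_eq (inf_comm _ _)) ((toCap N _ _).symm (app (B.right (eta h w)) X x)) := by
      intro B
      change B.toFun _ _ _ = res N _ (B.toFun _ _ _)
      rw [B.res_fun, res_res, res_res]
    rw [e, e, H1]
  ext X x y
  have e : ∀ (B : Bil ((pullback h).obj V) ((pullback h).obj W) N),
      B.toFun X x y = res N (le_of_eq (inf_idem _).symm) ((toCap N _ _).symm (app (B.left x) X y)) := by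
    intro B
    change _ = res N _ (B.toFun _ _ _)
    rw [B.res_fun, res_res, res_res, res_refl, res_refl]
  rw [e, e, H2]

section existence
variable (h : U ⟶ U') {V W : Sh U'} {N : Sh U} (B : Bil V W ((pushforward h).obj N))

/-- Extension of the map `B(v, -)`. -/
def ext1 {Ω : Opens U'.toTop} (v : Sec V Ω) : (pullback h).obj W ⟶ cap N (pre h Ω) :=
  extend h (mkHom (W := (pushforward h).obj (cap N (pre h Ω)))
    (fun Ω' w => toPf h _ _ (toCap N _ _ (res N (pre_inf h _ _) ((toPf h N _).symm
      (B.toFun (Ω' ⊓ Ω) (res V inf_le_right v) (res W inf_le_left w))))))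
    (fun Ω' w w' => by simp [B.add_right])
    (fun Ω' a w => by
      rw [res_smul, B.smul_right, toPf_symm_smul, res_smul, ← toPf_smul, ← toCap_smul]
      rfl)
    (fun Ω' Ω'' i w => by
      have e := B.res_fun _ (Ω'' ⊓ Ω) (inf_le_inf_right Ω i) (res V inf_le_right v)
        (res W inf_le_left w)
      rw [res_res, res_res] at e
      rw [res_toPf, res_toCap, res_res, res_res, ← e, ← res_toPf_symm, res_res]))

lemma ext1_eta {Ω Ω' : Opens U'.toTop} (v : Sec V Ω) (w : Sec W Ω') :
    app (ext1 h B v) _ (eta h w) = toCap N _ _ (res N (pre_inf h _ _) ((toPf h N _).symm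
      (B.toFun (Ω' ⊓ Ω) (res V inf_le_right v) (res W inf_le_left w)))) := by
  rw [ext1, extend_eta]
  rfl

lemma ext1_add {Ω : Opens U'.toTop} (v v' : Sec V Ω) {Y} (y : Sec _ Y) :
    app (ext1 h B (v + v')) Y y = app (ext1 h B v) Y y + app (ext1 h B v') Y y := by
  rw [← app_addHom]
  congr 2
  refine pullback_ext h fun Ω' w => ?_
  rw [app_addHom, ext1_eta, ext1_eta, ext1_eta]
  simp [B.add_left]

lemma ext1_smul {Ω : Opens U'.toTop} (a : U'.Fun Ω) (v : Sec V Ω) {Y} (y : Sec _ Y) :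
    app (ext1 h B (a • v)) Y y = app (capSmul N (comapF h Ω a)) Y (app (ext1 h B v) Y y) := by
  rw [← app_comp]
  congr 2
  refine pullback_ext h fun Ω' w => ?_
  rw [app_comp, ext1_eta, ext1_eta, res_smul, B.smul_left, toPf_symm_smul, res_smul, capSmul_toCap]
  rfl

lemma ext1_res {Ω Ω' : Opens U'.toTop} (i : Ω' ≤ Ω) (v : Sec V Ω) {Y} (y : Sec _ Y) :
    app (ext1 h B (res V i v)) Y y = app (capRes N (pre_mono h i)) Y (app (ext1 h B v) Y y) := by
  rw [← app_comp]
  congr 2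
  refine pullback_ext h fun Ω'' w => ?_
  have e := B.res_fun _ (Ω'' ⊓ Ω') (inf_le_inf_left Ω'' i) (res V inf_le_right v)
    (res W inf_le_left w)
  rw [res_res, res_res] at e
  rw [app_comp, ext1_eta, ext1_eta, capRes_toCap, res_res, res_res, ← e, ← res_toPf_symm, res_res]

/-- Extension in the first variable, with the second one fixed. -/
def ext2 {Y : Opens U.toTop} (y : Sec ((pullback h).obj W) Y) : (pullback h).obj V ⟶ cap N Y :=
  extend h (mkHom (W := (pushforward h).obj (cap N Y))
    (fun Ω v => toPf h _ _ (toCap N _ _ (res N (le_of_eq (inf_comm _ _))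
      ((toCap N _ _).symm (app (ext1 h B v) Y y)))))
    (fun Ω v v' => by simp [ext1_add])
    (fun Ω a v => by
      rw [ext1_smul, ← toPf_smul, ← toCap_smul]
      obtain ⟨s, hs⟩ := (toCap N _ _).surjective (app (ext1 h B v) Y y)
      rw [← hs, capSmul_toCap, AddEquiv.symm_apply_apply, AddEquiv.symm_apply_apply, res_smul]
      rfl)
    (fun Ω Ω' i v => by
      rw [res_toPf, res_toCap, ext1_res]
      obtain ⟨s, hs⟩ := (toCap N _ _).surjective (app (ext1 h B v) Y y)
      rw [← hs, capRes_toCap, AddEquiv.symm_apply_apply, AddEquiv.symm_apply_apply, res_res,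
        res_res]))

lemma ext2_eta {Y : Opens U.toTop} (y : Sec ((pullback h).obj W) Y) {Ω} (v : Sec V Ω) :
    app (ext2 h B y) _ (eta h v) = toCap N _ _ (res N (le_of_eq (inf_comm _ _))
      ((toCap N _ _).symm (app (ext1 h B v) Y y))) := by
  rw [ext2, extend_eta]
  rfl

lemma ext2_add {Y : Opens U.toTop} (y y' : Sec ((pullback h).obj W) Y) {X} (x : Sec _ X) :
    app (ext2 h B (y + y')) X x = app (ext2 h B y) X x + app (ext2 h B y') X x := by
  rw [← app_addHom]
  congr 2
  refine pullback_ext h fun Ω v => ?_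
  rw [app_addHom, ext2_eta, ext2_eta, ext2_eta]
  simp

lemma ext2_smul {Y : Opens U.toTop} (a : U.Fun Y) (y : Sec ((pullback h).obj W) Y)
    {X} (x : Sec _ X) :
    app (ext2 h B (a • y)) X x = app (capSmul N a) X (app (ext2 h B y) X x) := by
  rw [← app_comp]
  congr 2
  refine pullback_ext h fun Ω v => ?_
  rw [app_comp, ext2_eta, ext2_eta, capSmul_toCap, map_smul]
  obtain ⟨s, hs⟩ := (toCap N _ _).surjective (app (ext1 h B v) Y y)
  rw [← hs, ← toCap_smul, AddEquiv.symm_apply_apply, AddEquiv.symm_apply_apply, res_smul]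
  rfl

lemma ext2_res {Y Y' : Opens U.toTop} (i : Y' ≤ Y) (y : Sec ((pullback h).obj W) Y)
    {X} (x : Sec _ X) :
    app (ext2 h B (res _ i y)) X x = app (capRes N i) X (app (ext2 h B y) X x) := by
  rw [← app_comp]
  congr 2
  refine pullback_ext h fun Ω v => ?_
  rw [app_comp, ext2_eta, ext2_eta, capRes_toCap, app_res]
  obtain ⟨s, hs⟩ := (toCap N _ _).surjective (app (ext1 h B v) Y y)
  rw [← hs, res_toCap, AddEquiv.symm_apply_apply, AddEquiv.symm_apply_apply, res_res, res_res]

/-- The bilinear extension to pullbacks of a bilinear map with values in a pushforward. -/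
def extend : Bil ((pullback h).obj V) ((pullback h).obj W) N where
  toFun X x y := res N (le_of_eq (inf_idem _).symm) ((toCap N _ _).symm (app (ext2 h B y) X x))
  add_left X x x' y := by simp
  add_right X x y y' := by simp [ext2_add]
  smul_left X a x y := by
    obtain ⟨s, hs⟩ := (toCap N _ _).surjective (app (ext2 h B y) X x)
    rw [map_smul, ← hs, ← toCap_smul, AddEquiv.symm_apply_apply, AddEquiv.symm_apply_apply,
      res_smul, resF_resF, resF_refl]
  smul_right X a x y := by
    obtain ⟨s, hs⟩ := (toCap N _ _).surjective (app (ext2 h B y) X x)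
    rw [ext2_smul, ← hs, capSmul_toCap, AddEquiv.symm_apply_apply, AddEquiv.symm_apply_apply,
      res_smul, resF_resF, resF_refl]
  res_fun X X' i x y := by
    obtain ⟨s, hs⟩ := (toCap N _ _).surjective (app (ext2 h B y) X x)
    rw [ext2_res, app_res, ← hs, res_toCap, capRes_toCap, AddEquiv.symm_apply_apply,
      AddEquiv.symm_apply_apply, res_res, res_res, res_res]

lemma extend_eta {Ω} (v : Sec V Ω) (w : Sec W Ω) :
    (extend h B).toFun _ (eta h v) (eta h w) = (toPf h N _).symm (B.toFun Ω v w) := by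
  change res N _ ((toCap N _ _).symm (app (ext2 h B (eta h w)) _ (eta h v))) = _
  rw [ext2_eta, AddEquiv.symm_apply_apply, ext1_eta, AddEquiv.symm_apply_apply, res_res]
  have e := B.res_fun _ _ (le_of_eq (inf_idem Ω).symm) (res V inf_le_right v)
    (res W inf_le_left w)
  rw [res_res, res_res, res_refl, res_refl] at e
  rw [← e, ← res_toPf_symm, res_res]

end existence
end Bil

/-! tensor product -/

/-- The presheaf tensor product. -/
def preTensor (V W : Sh U) : PresheafOfModules.{0} (U.smoothFun.obj ⋙ forget₂ CommRingCat RingCat) :=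
  PresheafOfModules.Monoidal.tensorObj (R := U.smoothFun.obj) (SheafOfModules.val V)
    (SheafOfModules.val W)

/-- The tensor product of sheaves of modules: the sheaf associated with the presheaf
`Ω ↦ V(Ω) ⊗ W(Ω)`. -/
def tensor (V W : Sh U) : Sh U :=
  (PresheafOfModules.sheafification (R := U.ringSheaf) (𝟙 U.ringSheaf.obj)).obj (preTensor V W)

/-- Morphisms out of the tensor product are morphisms out of the presheaf tensor product. -/
def tensorEquiv (V W N : Sh U) :
    (tensor V W ⟶ N) ≃ (preTensor V W ⟶ (PresheafOfModules.restrictScalars (𝟙 U.ringSheaf.obj)).obj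
      (SheafOfModules.val N)) :=
  PresheafOfModules.sheafificationHomEquiv (R := U.ringSheaf) (𝟙 U.ringSheaf.obj)

/-- The canonical morphism from the presheaf tensor product to the tensor product. -/
def toTensor (V W : Sh U) : preTensor V W ⟶
  (PresheafOfModules.restrictScalars (𝟙 U.ringSheaf.obj)).obj (SheafOfModules.val (tensor V W)) :=
  tensorEquiv V W _ (𝟙 _)

/-- The section `v ⊗ w`. -/
def tmul {V W : Sh U} {Ω : Opens U.toTop} (v : Sec V Ω) (w : Sec W Ω) : Sec (tensor V W) Ω :=
  ((toTensor V W).app (op Ω)).hom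
    (TensorProduct.tmul (U.Fun Ω) (M := Sec V Ω) (N := Sec W Ω) v w)

lemma app_tmul {V W N : Sh U} (f : tensor V W ⟶ N) {Ω : Opens U.toTop} (v : Sec V Ω) (w : Sec W Ω) :
    app f Ω (tmul v w) = ((tensorEquiv V W N f).app (op Ω)).hom
      (TensorProduct.tmul (U.Fun Ω) (M := Sec V Ω) (N := Sec W Ω) v w) := by
  have := (PresheafOfModules.sheafificationAdjunction (R := U.ringSheaf)
    (𝟙 U.ringSheaf.obj)).homEquiv_naturality_right (X := preTensor V W) (𝟙 (tensor V W)) f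
  erw [Category.id_comp] at this
  exact (congrArg (fun (k : preTensor V W ⟶ _) => (k.app (op Ω)).hom
    (TensorProduct.tmul (U.Fun Ω) (M := Sec V Ω) (N := Sec W Ω) v w)) this).symm

section
variable {V W N : Sh U} {Ω : Opens U.toTop}

lemma tmul_add (v : Sec V Ω) (w w' : Sec W Ω) : tmul v (w + w') = tmul v w + tmul v w' := by
  rw [tmul, TensorProduct.tmul_add]
  exact map_add _ _ _

lemma add_tmul (v v' : Sec V Ω) (w : Sec W Ω) : tmul (v + v') w = tmul v w + tmul v' w := by
  rw [tmul, TensorProduct.add_tmul]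
  exact map_add _ _ _

lemma smul_tmul (a : U.Fun Ω) (v : Sec V Ω) (w : Sec W Ω) : tmul (a • v) w = a • tmul v w := by
  rw [tmul, ← TensorProduct.smul_tmul']
  exact ((toTensor V W).app (op Ω)).hom.map_smul a _

lemma tmul_smul (a : U.Fun Ω) (v : Sec V Ω) (w : Sec W Ω) : tmul v (a • w) = a • tmul v w := by
  rw [tmul, TensorProduct.tmul_smul]
  exact ((toTensor V W).app (op Ω)).hom.map_smul a _

lemma res_tmul {Ω' : Opens U.toTop} (i : Ω' ≤ Ω) (v : Sec V Ω) (w : Sec W Ω) :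
    res _ i (tmul v w) = tmul (res V i v) (res W i w) :=
  (PresheafOfModules.naturality_apply (toTensor V W) (homOfLE i).op _).symm

/-- The bilinear map corresponding to a morphism from the tensor product. -/
def toBil (f : tensor V W ⟶ N) : Bil V W N where
  toFun Ω v w := app f Ω (tmul v w)
  add_left Ω v v' w := by rw [add_tmul, map_add]
  add_right Ω v v' w := by rw [tmul_add, map_add]
  smul_left Ω a v w := by rw [smul_tmul, map_smul]
  smul_right Ω a v w := by rw [tmul_smul, map_smul]
  res_fun Ω Ω' i v w := by rw [← res_tmul, app_res]

/-- The morphism from the tensor product that corresponds to a bilinear map. -/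
def lift (B : Bil V W N) : tensor V W ⟶ N :=
  (tensorEquiv V W N).symm
    { app X := ModuleCat.ofHom (R := U.Fun X.unop) (X := TensorProduct (U.Fun X.unop) (Sec V X.unop) (Sec W X.unop))
        (Y := Sec N X.unop) (TensorProduct.lift (LinearMap.mk₂ (U.Fun X.unop) (B.toFun X.unop)
          (B.add_left _) (B.smul_left _) (B.add_right _) (B.smul_right _)))
      naturality {X Y} g := by
        refine ModuleCat.MonoidalCategory.tensor_ext (R := U.Fun X.unop) (M₁ := ModuleCat.of _ (Sec V X.unop))
          (M₂ := ModuleCat.of _ (Sec W X.unop)) ?_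
        intro v w
        exact (B.res_fun X.unop Y.unop g.unop.le v w).symm }

@[simp] lemma lift_tmul (B : Bil V W N) (v : Sec V Ω) (w : Sec W Ω) :
    app (lift B) Ω (tmul v w) = B.toFun Ω v w := by
  rw [app_tmul, lift, Equiv.apply_symm_apply]
  rfl

lemma tensor_ext {f g : tensor V W ⟶ N}
    (H : ∀ Ω (v : Sec V Ω) (w : Sec W Ω), app f Ω (tmul v w) = app g Ω (tmul v w)) : f = g := by
  apply (tensorEquiv V W N).injective
  apply PresheafOfModules.hom_ext
  intro X
  refine ModuleCat.MonoidalCategory.tensor_ext (R := U.Fun X.unop) (M₁ := ModuleCat.of _ (Sec V X.unop))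
    (M₂ := ModuleCat.of _ (Sec W X.unop)) ?_
  intro v w
  have := H X.unop v w
  rw [app_tmul, app_tmul] at this
  exact this

end

/-- The tensor product of two morphisms. -/
def tensorMap {V V' W W' : Sh U} (f : V ⟶ V') (g : W ⟶ W') : tensor V W ⟶ tensor V' W' :=
  lift { toFun Ω v w := tmul (app f Ω v) (app g Ω w)
         add_left := by simp [add_tmul]
         add_right := by simp [tmul_add]
         smul_left := by simp [smul_tmul]
         smul_right := by simp [tmul_smul]
         res_fun := by simp [res_tmul, app_res] }

@[simp] lemma tensorMap_tmul {V V' W W' : Sh U} (f : V ⟶ V') (g : W ⟶ W') {Ω : Opens U.toTop}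
    (v : Sec V Ω) (w : Sec W Ω) : app (tensorMap f g) Ω (tmul v w) = tmul (app f Ω v) (app g Ω w) :=
  lift_tmul _ _ _

/-- The symmetric braiding `v ⊗ w ↦ w ⊗ v`. -/
def braiding (V W : Sh U) : tensor V W ⟶ tensor W V :=
  lift { toFun Ω v w := tmul w v
         add_left := by simp [tmul_add]
         add_right := by simp [add_tmul]
         smul_left := by simp [tmul_smul]
         smul_right := by simp [smul_tmul]
         res_fun := by simp [res_tmul] }

@[simp] lemma braiding_tmul {V W : Sh U} {Ω : Opens U.toTop} (v : Sec V Ω) (w : Sec W Ω) :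
    app (braiding V W) Ω (tmul v w) = tmul w v :=
  lift_tmul _ _ _

/-! conjugation -/

/-- An open subset of the underlying space, as a submanifold. -/
abbrev toOpens (Ω : Opens U.toTop) : Opens U.carrier := Ω

/-- Pointwise complex conjugation of smooth functions. -/
def conjF (Ω : Opens U.toTop) : U.Fun Ω →+* U.Fun Ω where
  toFun a := show C^∞⟮𝓡 U.dim, (toOpens Ω); 𝓘(ℝ, ℂ), ℂ⟯ from
    ⟨fun x => (starRingEnd ℂ) (a.1 x), Complex.conjCLE.contDiff.contMDiff.comp a.2⟩
  map_one' := Subtype.ext (funext fun _ => map_one (starRingEnd ℂ))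
  map_zero' := Subtype.ext (funext fun _ => map_zero (starRingEnd ℂ))
  map_mul' a b := Subtype.ext (funext fun x => map_mul (starRingEnd ℂ) (a.1 x) (b.1 x))
  map_add' a b := Subtype.ext (funext fun x => map_add (starRingEnd ℂ) (a.1 x) (b.1 x))

@[simp] lemma conjF_conjF (Ω : Opens U.toTop) (a : U.Fun Ω) : conjF Ω (conjF Ω a) = a :=
  Subtype.ext (funext fun _ => Complex.conj_conj _)

lemma comapF_conjF (h : U ⟶ U') (Ω : Opens U'.toTop) (a : U'.Fun Ω) :
    comapF h Ω (conjF Ω a) = conjF _ (comapF h Ω a) := rfl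

/-- Complex conjugation as a morphism of sheaves of rings. -/
def conjRing (U : Man) : U.ringSheaf ⟶
    ((𝟭 (Opens U.toTop)).sheafPushforwardContinuous _ (Opens.grothendieckTopology U.toTop)
      (Opens.grothendieckTopology U.toTop)).obj U.ringSheaf where
  hom :=
    { app X := RingCat.ofHom (conjF (U := U) X.unop)
      naturality _ _ _ := rfl }

/-- The conjugate of a sheaf of modules: the same sheaf of abelian groups, functions acting through
their complex conjugates. -/
def conj (U : Man) : Sh U ⥤ Sh U := SheafOfModules.pushforward.{0} (conjRing U)

/-- A section of `V` as a section of the conjugate of `V`. -/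
def toConj (V : Sh U) (Ω : Opens U.toTop) : Sec V Ω ≃+ Sec ((conj U).obj V) Ω := AddEquiv.refl _

lemma toConj_smul (V : Sh U) {Ω : Opens U.toTop} (a : U.Fun Ω) (v : Sec V Ω) :
    toConj V Ω (a • v) = conjF Ω a • toConj V Ω v := by
  rw [← conjF_conjF Ω a]
  nth_rw 2 [conjF_conjF]
  rfl

lemma toConj_symm_smul (V : Sh U) {Ω : Opens U.toTop} (a : U.Fun Ω) (v : Sec ((conj U).obj V) Ω) :
    (toConj V Ω).symm (a • v) = conjF Ω a • (toConj V Ω).symm v := rfl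

lemma res_toConj (V : Sh U) {Ω Ω' : Opens U.toTop} (i : Ω' ≤ Ω) (v : Sec V Ω) :
    res _ i (toConj V Ω v) = toConj V Ω' (res V i v) := rfl

lemma res_toConj_symm (V : Sh U) {Ω Ω' : Opens U.toTop} (i : Ω' ≤ Ω) (v : Sec ((conj U).obj V) Ω) :
    res _ i ((toConj V Ω).symm v) = (toConj V Ω').symm (res _ i v) := rfl

lemma conj_map_toConj {V W : Sh U} (f : V ⟶ W) {Ω : Opens U.toTop} (v : Sec V Ω) :
    app ((conj U).map f) Ω (toConj V Ω v) = toConj W Ω (app f Ω v) := rfl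

/-- The identification of `V` with its double conjugate. -/
def conjConj (V : Sh U) : V ⟶ (conj U).obj ((conj U).obj V) :=
  mkHom (fun Ω v => toConj _ Ω (toConj V Ω v)) (by simp)
    (by simp [toConj_smul]) (by simp [res_toConj])

/-- The canonical morphism from the tensor product of the conjugates to the conjugate of the
tensor product, `v ⊗ w ↦ v ⊗ w`. -/
def conjTensor (V W : Sh U) :
    tensor ((conj U).obj V) ((conj U).obj W) ⟶ (conj U).obj (tensor V W) :=
  lift { toFun Ω v w := toConj _ Ω (tmul ((toConj V Ω).symm v) ((toConj W Ω).symm w))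
         add_left := by simp [add_tmul]
         add_right := by simp [tmul_add]
         smul_left := by simp [smul_tmul, toConj_symm_smul, toConj_smul]
         smul_right := by simp [tmul_smul, toConj_symm_smul, toConj_smul]
         res_fun := by simp [res_tmul, res_toConj, res_toConj_symm] }

lemma conjTensor_tmul {V W : Sh U} {Ω : Opens U.toTop} (v : Sec ((conj U).obj V) Ω) (w) :
    app (conjTensor V W) Ω (tmul v w) =
      toConj _ Ω (tmul ((toConj V Ω).symm v) ((toConj W Ω).symm w)) :=
  lift_tmul _ _ _

/-- A section of the structure sheaf. -/
def toUnit (Ω : Opens U.toTop) : U.Fun Ω ≃+ Sec (unit U) Ω := AddEquiv.refl _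

lemma smul_toUnit (Ω : Opens U.toTop) (a b : U.Fun Ω) : a • toUnit Ω b = toUnit Ω (a * b) := rfl

lemma res_toUnit {Ω Ω' : Opens U.toTop} (i : Ω' ≤ Ω) (a : U.Fun Ω) :
    res (unit U) i (toUnit Ω a) = toUnit Ω' (resF i a) := rfl

/-- The standard `*`-structure of the sheaf of smooth functions: complex conjugation. -/
def unitStar (U : Man) : unit U ⟶ (conj U).obj (unit U) :=
  mkHom (fun Ω a => toConj _ Ω (toUnit Ω (conjF Ω ((toUnit Ω).symm a)))) (by simp)
    (fun Ω a b => by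
      obtain ⟨b, rfl⟩ := (toUnit Ω).surjective b
      rw [smul_toUnit, AddEquiv.symm_apply_apply, AddEquiv.symm_apply_apply, map_mul,
        ← smul_toUnit, toConj_smul, conjF_conjF])
    (fun Ω Ω' i b => rfl)

/-! coherence isomorphisms -/

lemma pre_id (Ω : Opens U.toTop) : pre (𝟙 U) Ω ≤ Ω := fun _ hx => hx

lemma le_pre_id (Ω : Opens U.toTop) : Ω ≤ pre (𝟙 U) Ω := fun _ hx => hx

lemma pre_comp (h : U ⟶ U') (h' : U' ⟶ U'') (Ω : Opens U''.toTop) :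
    pre h (pre h' Ω) ≤ pre (h ≫ h') Ω := fun _ hx => hx

lemma le_pre_comp (h : U ⟶ U') (h' : U' ⟶ U'') (Ω : Opens U''.toTop) :
    pre (h ≫ h') Ω ≤ pre h (pre h' Ω) := fun _ hx => hx

lemma pullback_ext₂ (h : U ⟶ U') (h' : U' ⟶ U'') {V : Sh U''} {N : Sh U}
    {f g : (pullback h).obj ((pullback h').obj V) ⟶ N}
    (H : ∀ Ω (v : Sec V Ω), app f _ (eta h (eta h' v)) = app g _ (eta h (eta h' v))) : f = g := by
  have : etaHom h _ ≫ (pushforward h).map f = etaHom h _ ≫ (pushforward h).map g :=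
    pullback_ext h' fun Ω v => H Ω v
  refine pullback_ext h fun Ω v => ?_
  exact congrArg (fun k => app k Ω v) this

/-- The canonical morphism from the pullback along the identity. -/
def idHom (V : Sh U) : (pullback (𝟙 U)).obj V ⟶ V :=
  extend (𝟙 U) (mkHom (fun Ω v => toPf (𝟙 U) V Ω (res V (pre_id Ω) v))
    (by simp) (fun Ω a v => by rw [res_smul, ← toPf_smul]; rfl) (by simp [res_toPf]))

lemma idHom_eta {V : Sh U} {Ω : Opens U.toTop} (v : Sec V Ω) :
    app (idHom V) _ (eta (𝟙 U) v) = res V (pre_id Ω) v := by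
  rw [idHom, extend_eta, app_mkHom, AddEquiv.symm_apply_apply]

/-- The canonical morphism to the pullback along the identity. -/
def idInv (V : Sh U) : V ⟶ (pullback (𝟙 U)).obj V :=
  mkHom (fun Ω v => res _ (le_pre_id Ω) (eta (𝟙 U) v))
    (by simp [eta_add]) (fun Ω a v => by rw [eta_smul, res_smul]; rfl)
    (fun Ω Ω' i v => by rw [← res_eta, res_res, res_res])

lemma idInv_app {V : Sh U} {Ω : Opens U.toTop} (v : Sec V Ω) :
    app (idInv V) Ω v = res _ (le_pre_id Ω) (eta (𝟙 U) v) := rfl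

/-- The canonical isomorphism between the pullback along the identity and the identity. -/
def pullbackId (U : Man) : pullback (𝟙 U) ≅ 𝟭 (Sh U) :=
  NatIso.ofComponents (fun V => Iso.mk (C := Sh U) (X := (pullback (𝟙 U)).obj V) (Y := V)
      (idHom V) (idInv V)
      (pullback_ext (𝟙 U) fun Ω v => by
        rw [app_comp, idHom_eta, idInv_app, ← res_eta, res_res, res_refl, app_id])
      (hom_ext fun Ω v => by
        rw [app_comp, idInv_app, app_res, idHom_eta, res_res, res_refl, app_id]))
    (fun {V W} f => show (pullback (𝟙 U)).map f ≫ idHom W = idHom V ≫ f from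
      pullback_ext (𝟙 U) fun Ω v => by
        rw [app_comp, app_comp, pullback_map_eta, idHom_eta, idHom_eta, app_res])

section
variable (h : U ⟶ U') (h' : U' ⟶ U'')

/-- The canonical morphism from the composition of two pullbacks. -/
def compHom (V : Sh U'') :
    (pullback h).obj ((pullback h').obj V) ⟶ (pullback (h ≫ h')).obj V :=
  extend h (extend h' (mkHom (W := (pushforward h').obj ((pushforward h).obj
      ((pullback (h ≫ h')).obj V)))
    (fun Ω v => toPf h' _ _ (toPf h _ _ (res _ (pre_comp h h' Ω) (eta (h ≫ h') v))))
    (by simp [eta_add])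
    (fun Ω a v => by rw [eta_smul, res_smul, ← toPf_smul, ← toPf_smul]; rfl)
    (fun Ω Ω' i v => by rw [res_toPf, res_toPf, ← res_eta, res_res, res_res])))

/-- The canonical morphism to the composition of two pullbacks. -/
def compInv (V : Sh U'') :
    (pullback (h ≫ h')).obj V ⟶ (pullback h).obj ((pullback h').obj V) :=
  extend (h ≫ h') (mkHom
    (fun Ω v => toPf (h ≫ h') _ _ (res _ (le_pre_comp h h' Ω) (eta h (eta h' v))))
    (by simp [eta_add])
    (fun Ω a v => by rw [eta_smul, eta_smul, res_smul, ← toPf_smul]; rfl)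
    (fun Ω Ω' i v => by rw [res_toPf, ← res_eta, ← res_eta, res_res, res_res]))

variable {V : Sh U''} {Ω : Opens U''.toTop}

lemma compHom_eta (v : Sec V Ω) : app (compHom h h' V) _ (eta h (eta h' v)) =
      res _ (pre_comp h h' Ω) (eta (h ≫ h') v) := by
  rw [compHom, extend_eta, extend_eta, app_mkHom, AddEquiv.symm_apply_apply,
    AddEquiv.symm_apply_apply]

lemma compInv_eta (v : Sec V Ω) : app (compInv h h' V) _ (eta (h ≫ h') v) =
      res _ (le_pre_comp h h' Ω) (eta h (eta h' v)) := by
  rw [compInv, extend_eta, app_mkHom, AddEquiv.symm_apply_apply]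

/-- The canonical isomorphism between the composition of two pullbacks and the pullback along
the composition. -/
def pullbackComp : pullback h' ⋙ pullback h ≅ pullback (h ≫ h') :=
  NatIso.ofComponents (fun V => Iso.mk (C := Sh U) (X := (pullback h).obj ((pullback h').obj V))
      (Y := (pullback (h ≫ h')).obj V) (compHom h h' V) (compInv h h' V)
      (pullback_ext₂ h h' fun Ω v => by
        rw [app_comp, compHom_eta, app_res, compInv_eta, res_res, res_refl, app_id])
      (pullback_ext (h ≫ h') fun Ω v => by
        rw [app_comp, compInv_eta, app_res, compHom_eta, res_res, res_refl, app_id]))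
    (fun {V W} f => show (pullback h).map ((pullback h').map f) ≫ compHom h h' W =
        compHom h h' V ≫ (pullback (h ≫ h')).map f from
      pullback_ext₂ h h' fun Ω v => by
        rw [app_comp, app_comp, pullback_map_eta, pullback_map_eta, compHom_eta, compHom_eta,
          app_res, pullback_map_eta])

end

/-! compatibility of pullback with the structures -/

section
variable (h : U ⟶ U')

/-- The canonical morphism from the pullback of the conjugate to the conjugate of the pullback. -/
def pullbackConj (V : Sh U') :
    (pullback h).obj ((conj U').obj V) ⟶ (conj U).obj ((pullback h).obj V) :=
  extend h (mkHom
    (fun Ω v => toPf h ((conj U).obj ((pullback h).obj V)) Ω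
      (toConj _ _ (eta h ((toConj V Ω).symm v))))
    (by simp [eta_add])
    (fun Ω a v => by
      rw [toConj_symm_smul, eta_smul, toConj_smul, ← comapF_conjF, conjF_conjF, ← toPf_smul])
    (fun Ω Ω' i v => by rw [res_toPf, res_toConj, res_eta, res_toConj_symm]))

lemma pullbackConj_eta {V : Sh U'} {Ω : Opens U'.toTop} (v : Sec V Ω) :
    app (pullbackConj h V) _ (eta h (toConj V Ω v)) = toConj _ _ (eta h v) := by
  rw [pullbackConj, extend_eta, app_mkHom, AddEquiv.symm_apply_apply, AddEquiv.symm_apply_apply]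

/-- The canonical morphism from the pullback of the structure sheaf to the structure sheaf. -/
def pullbackUnit : (pullback h).obj (unit U') ⟶ unit U :=
  extend h (mkHom (fun Ω a => toPf h (unit U) Ω (toUnit _ (comapF h Ω ((toUnit Ω).symm a))))
    (by simp)
    (fun Ω a b => by
      obtain ⟨b, rfl⟩ := (toUnit Ω).surjective b
      rw [smul_toUnit, AddEquiv.symm_apply_apply, AddEquiv.symm_apply_apply, map_mul,
        ← smul_toUnit, toPf_smul])
    (fun Ω Ω' i a => by
      obtain ⟨a, rfl⟩ := (toUnit Ω).surjective a
      rw [res_toUnit, AddEquiv.symm_apply_apply, AddEquiv.symm_apply_apply, res_toPf,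
        res_toUnit, resF_comapF]))

lemma pullbackUnit_eta {Ω : Opens U'.toTop} (a : U'.Fun Ω) :
    app (pullbackUnit h) _ (eta h (toUnit Ω a)) = toUnit _ (comapF h Ω a) := by
  rw [pullbackUnit, extend_eta, app_mkHom, AddEquiv.symm_apply_apply, AddEquiv.symm_apply_apply]

/-- The canonical morphism from the tensor product of the pullbacks to the pullback of the tensor
product, given by `h^*v ⊗ h^*w ↦ h^*(v ⊗ w)`. -/
def pullbackTensor (V W : Sh U') :
    tensor ((pullback h).obj V) ((pullback h).obj W) ⟶ (pullback h).obj (tensor V W) :=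
  lift (Bil.extend h (toBil (etaHom h (tensor V W))))

lemma pullbackTensor_eta {V W : Sh U'} {Ω : Opens U'.toTop} (v : Sec V Ω) (w : Sec W Ω) :
    app (pullbackTensor h V W) _ (tmul (eta h v) (eta h w)) = eta h (tmul v w) := by
  rw [pullbackTensor, lift_tmul, Bil.extend_eta]
  rfl

lemma tensor_pullback_ext {V W : Sh U'} {N : Sh U}
    {f g : tensor ((pullback h).obj V) ((pullback h).obj W) ⟶ N}
    (H : ∀ Ω (v : Sec V Ω) (w : Sec W Ω),
      app f _ (tmul (eta h v) (eta h w)) = app g _ (tmul (eta h v) (eta h w))) : f = g := by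
  have : toBil f = toBil g := Bil.ext_of_eta h H
  refine tensor_ext fun Ω v w => ?_
  exact congrArg (fun B => Bil.toFun B Ω v w) this

/-- The bilinear map of pulled back sections. -/
def etaBil {V W : Sh U'} {N : Sh U} (f : tensor ((pullback h).obj V) ((pullback h).obj W) ⟶ N) :
    Bil V W ((pushforward h).obj N) where
  toFun Ω v w := toPf h N Ω (app f _ (tmul (eta h v) (eta h w)))
  add_left := by simp [eta_add, add_tmul]
  add_right := by simp [eta_add, tmul_add]
  smul_left Ω a v w := by rw [eta_smul, smul_tmul, map_smul, toPf_smul]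
  smul_right Ω a v w := by rw [eta_smul, tmul_smul, map_smul, toPf_smul]
  res_fun Ω Ω' i v w := by rw [res_toPf, ← app_res, res_tmul, res_eta, res_eta]

lemma tensor_pullback_ext₂ (h' : U' ⟶ U'') {V W : Sh U''} {N : Sh U}
    {f g : tensor ((pullback h).obj ((pullback h').obj V))
      ((pullback h).obj ((pullback h').obj W)) ⟶ N}
    (H : ∀ Ω (v : Sec V Ω) (w : Sec W Ω), app f _ (tmul (eta h (eta h' v)) (eta h (eta h' w))) =
      app g _ (tmul (eta h (eta h' v)) (eta h (eta h' w)))) : f = g := by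
  have : etaBil h f = etaBil h g := Bil.ext_of_eta h' H
  refine tensor_pullback_ext h fun Ω v w => ?_
  exact congrArg (fun B => Bil.toFun B Ω v w) this

end

/-! `*`-structures and pairings on sections -/

lemma app_comm {V W : Sh U} {f g : V ⟶ W} (H : f = g) {Ω : Opens U.toTop} (v : Sec V Ω) :
    app f Ω v = app g Ω v := by rw [H]

section
variable {V W : Sh U} {Ω : Opens U.toTop}

/-- A `*`-structure on sections. -/
def st (s : V ⟶ (conj U).obj V) (v : Sec V Ω) : Sec V Ω := (toConj _ Ω).symm (app s Ω v)

lemma app_star (s : V ⟶ (conj U).obj V) (v : Sec V Ω) : app s Ω v = toConj _ Ω (st s v) :=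
  ((toConj _ Ω).apply_symm_apply _).symm

lemma res_st (s : V ⟶ (conj U).obj V) {Ω' : Opens U.toTop} (i : Ω' ≤ Ω) (v : Sec V Ω) :
    res V i (st s v) = st s (res V i v) := by
  rw [st, st, app_res, res_toConj_symm]

/-- A pairing on sections. -/
def ip (p : tensor V V ⟶ unit U) (v w : Sec V Ω) : U.Fun Ω := (toUnit Ω).symm (app p Ω (tmul v w))

lemma app_pairing (p : tensor V V ⟶ unit U) (v w : Sec V Ω) :
    app p Ω (tmul v w) = toUnit Ω (ip p v w) :=
  ((toUnit Ω).apply_symm_apply _).symm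

lemma res_ip (p : tensor V V ⟶ unit U) {Ω' : Opens U.toTop} (i : Ω' ≤ Ω) (v w : Sec V Ω) :
    resF i (ip p v w) = ip p (res V i v) (res V i w) := by
  apply (toUnit Ω').injective
  rw [← res_toUnit, ← app_pairing, ← app_pairing, ← app_res, res_tmul]

lemma unitStar_apply (a : U.Fun Ω) :
    app (unitStar U) Ω (toUnit Ω a) = toConj _ Ω (toUnit Ω (conjF Ω a)) := rfl

lemma st_conj_map {s : V ⟶ (conj U).obj V} {t : W ⟶ (conj U).obj W} {f : V ⟶ W} {v : Sec V Ω} :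
    app (s ≫ (conj U).map f) Ω v = app (f ≫ t) Ω v ↔ app f Ω (st s v) = st t (app f Ω v) := by
  rw [app_comp, app_comp, app_star, conj_map_toConj, app_star, (toConj _ Ω).injective.eq_iff]

lemma st_conjConj {s : V ⟶ (conj U).obj V} {v : Sec V Ω} :
    app (s ≫ (conj U).map s) Ω v = app (conjConj V) Ω v ↔ st s (st s v) = v := by
  rw [app_comp, app_star s, conj_map_toConj, app_star s]
  exact (toConj _ Ω).injective.eq_iff.trans (toConj _ Ω).injective.eq_iff

lemma ip_map {p : tensor V V ⟶ unit U} {q : tensor W W ⟶ unit U} {f : V ⟶ W} {v w : Sec V Ω} :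
    app (tensorMap f f ≫ q) Ω (tmul v w) = app p Ω (tmul v w) ↔
      ip q (app f Ω v) (app f Ω w) = ip p v w := by
  rw [app_comp, tensorMap_tmul, app_pairing, app_pairing, (toUnit Ω).injective.eq_iff]

lemma ip_braiding {p : tensor V V ⟶ unit U} {v w : Sec V Ω} :
    app (braiding V V ≫ p) Ω (tmul v w) = app p Ω (tmul v w) ↔ ip p w v = ip p v w := by
  rw [app_comp, braiding_tmul, app_pairing, app_pairing, (toUnit Ω).injective.eq_iff]

lemma ip_star {s : V ⟶ (conj U).obj V} {p : tensor V V ⟶ unit U} {v w : Sec V Ω} :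
    app (tensorMap s s ≫ conjTensor V V ≫ (conj U).map p) Ω (tmul v w) =
      app (p ≫ unitStar U) Ω (tmul v w) ↔ ip p (st s v) (st s w) = conjF Ω (ip p v w) := by
  rw [app_comp, app_comp, app_comp, tensorMap_tmul, conjTensor_tmul, conj_map_toConj,
    app_star, app_star, AddEquiv.symm_apply_apply, AddEquiv.symm_apply_apply,
    app_pairing, app_pairing, unitStar_apply, (toConj _ Ω).injective.eq_iff,
    (toUnit Ω).injective.eq_iff]

end

section
variable (h : U ⟶ U') {V : Sh U'} {Ω : Opens U'.toTop}

/-- The `*`-structure of the pullback. -/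
def pullbackStar (s : V ⟶ (conj U').obj V) : (pullback h).obj V ⟶ (conj U).obj ((pullback h).obj V) :=
  (pullback h).map s ≫ pullbackConj h V

lemma st_eta (s : V ⟶ (conj U').obj V) (v : Sec V Ω) :
    st (pullbackStar h s) (eta h v) = eta h (st s v) := by
  apply (toConj _ _).injective
  rw [← app_star, pullbackStar, app_comp, pullback_map_eta, app_star, pullbackConj_eta]

/-- The pairing of the pullback. -/
def pullbackPairing (p : tensor V V ⟶ unit U') :
    tensor ((pullback h).obj V) ((pullback h).obj V) ⟶ unit U :=
  pullbackTensor h V V ≫ (pullback h).map p ≫ pullbackUnit h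

lemma ip_eta (p : tensor V V ⟶ unit U') (v w : Sec V Ω) :
    ip (pullbackPairing h p) (eta h v) (eta h w) = comapF h Ω (ip p v w) := by
  apply (toUnit _).injective
  rw [← app_pairing, pullbackPairing, app_comp, app_comp, pullbackTensor_eta, pullback_map_eta,
    app_pairing, pullbackUnit_eta]

lemma pullbackStar_star {s : V ⟶ (conj U').obj V} (H : s ≫ (conj U').map s = conjConj V) :
    pullbackStar h s ≫ (conj U).map (pullbackStar h s) = conjConj _ :=
  pullback_ext h fun Ω v => by rw [st_conjConj, st_eta, st_eta, st_conjConj.1 (app_comm H v)]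

lemma pullbackPairing_symm {p : tensor V V ⟶ unit U'} (H : braiding V V ≫ p = p) :
    braiding _ _ ≫ pullbackPairing h p = pullbackPairing h p :=
  tensor_pullback_ext h fun Ω v w => by
    rw [ip_braiding, ip_eta, ip_eta, ip_braiding.1 (app_comm H (tmul v w))]

lemma pullbackStar_pairing {s : V ⟶ (conj U').obj V} {p : tensor V V ⟶ unit U'}
    (H : tensorMap s s ≫ conjTensor V V ≫ (conj U').map p = p ≫ unitStar U') :
    tensorMap (pullbackStar h s) (pullbackStar h s) ≫ conjTensor _ _ ≫
      (conj U).map (pullbackPairing h p) = pullbackPairing h p ≫ unitStar U :=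
  tensor_pullback_ext h fun Ω v w => by
    rw [ip_star, st_eta, st_eta, ip_eta, ip_eta, ip_star.1 (app_comm H (tmul v w)), comapF_conjF]

lemma pullbackStar_map {W : Sh U'} {s : V ⟶ (conj U').obj V} {t : W ⟶ (conj U').obj W} {f : V ⟶ W}
    (H : s ≫ (conj U').map f = f ≫ t) :
    pullbackStar h s ≫ (conj U).map ((pullback h).map f) =
      (pullback h).map f ≫ pullbackStar h t :=
  pullback_ext h fun Ω v => by
    rw [st_conj_map, st_eta, pullback_map_eta, pullback_map_eta, st_eta,
      st_conj_map.1 (app_comm H v)]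

lemma pullbackPairing_map {W : Sh U'} {p : tensor V V ⟶ unit U'} {q : tensor W W ⟶ unit U'}
    {f : V ⟶ W} (H : tensorMap f f ≫ q = p) :
    tensorMap ((pullback h).map f) ((pullback h).map f) ≫ pullbackPairing h q =
      pullbackPairing h p :=
  tensor_pullback_ext h fun Ω v w => by
    rw [ip_map, pullback_map_eta, pullback_map_eta, ip_eta, ip_eta,
      ip_map.1 (app_comm H (tmul v w))]

end

lemma idHom_star {V : Sh U} (s : V ⟶ (conj U).obj V) :
    pullbackStar (𝟙 U) s ≫ (conj U).map (idHom V) = idHom V ≫ s :=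
  pullback_ext (𝟙 U) fun Ω v => by
    rw [st_conj_map, st_eta, idHom_eta, idHom_eta, res_st]

lemma idHom_pairing {V : Sh U} (p : tensor V V ⟶ unit U) :
    tensorMap (idHom V) (idHom V) ≫ p = pullbackPairing (𝟙 U) p :=
  tensor_pullback_ext (𝟙 U) fun Ω v w => by
    rw [ip_map, ip_eta, idHom_eta, idHom_eta, ← res_ip]
    rfl

lemma compHom_star (h : U ⟶ U') (h' : U' ⟶ U'') {V : Sh U''} (s : V ⟶ (conj U'').obj V) :
    pullbackStar h (pullbackStar h' s) ≫ (conj U).map (compHom h h' V) =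
      compHom h h' V ≫ pullbackStar (h ≫ h') s :=
  pullback_ext₂ h h' fun Ω v => by
    rw [st_conj_map, st_eta, st_eta, compHom_eta, compHom_eta, ← res_st, st_eta]

lemma compHom_pairing (h : U ⟶ U') (h' : U' ⟶ U'') {V : Sh U''} (p : tensor V V ⟶ unit U'') :
    tensorMap (compHom h h' V) (compHom h h' V) ≫ pullbackPairing (h ≫ h') p =
      pullbackPairing h (pullbackPairing h' p) :=
  tensor_pullback_ext₂ h h' fun Ω v w => by
    rw [ip_map, ip_eta, ip_eta, compHom_eta, compHom_eta, ← res_ip, ip_eta]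
    rfl

/-! inner product vector sheaves -/

/-- An object of `IPVec(U)`: a `*`-object in the sheaves of modules over the smooth complex
functions on `U`, with a symmetric `*`-compatible pairing. -/
structure IPVec (U : Man) where
  /-- the sheaf of modules -/
  sheaf : Sh U
  /-- the `*`-structure -/
  star : sheaf ⟶ (conj U).obj sheaf
  /-- the `*`-structure is involutive -/
  star_star : star ≫ (conj U).map star = conjConj sheaf
  /-- the pairing -/
  pairing : tensor sheaf sheaf ⟶ unit U
  /-- the pairing is symmetric -/
  symm : braiding sheaf sheaf ≫ pairing = pairing
  /-- the pairing is a `*`-morphism -/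
  star_pairing : tensorMap star star ≫ conjTensor sheaf sheaf ≫ (conj U).map pairing =
    pairing ≫ unitStar U

namespace IPVec

/-- A morphism of `IPVec(U)`: a `*`-morphism preserving the pairings. -/
@[ext] structure Hom (X Y : IPVec U) where
  /-- the morphism of sheaves of modules -/
  hom : X.sheaf ⟶ Y.sheaf
  star_hom : X.star ≫ (conj U).map hom = hom ≫ Y.star
  pairing_hom : tensorMap hom hom ≫ Y.pairing = X.pairing

lemma tensorMap_id (V W : Sh U) : tensorMap (𝟙 V) (𝟙 W) = 𝟙 _ :=
  tensor_ext fun Ω v w => by rw [tensorMap_tmul]; rfl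

lemma tensorMap_comp {V V' V'' W W' W'' : Sh U} (f : V ⟶ V') (f' : V' ⟶ V'') (g : W ⟶ W')
    (g' : W' ⟶ W'') : tensorMap (f ≫ f') (g ≫ g') = tensorMap f g ≫ tensorMap f' g' :=
  tensor_ext fun Ω v w => by
    rw [tensorMap_tmul, app_comp, app_comp, app_comp, tensorMap_tmul, tensorMap_tmul]

instance : Category (IPVec U) where
  Hom := Hom
  id X := ⟨𝟙 _, by simp, by rw [tensorMap_id, Category.id_comp]⟩
  comp f g := ⟨f.hom ≫ g.hom, by
      rw [Functor.map_comp, ← Category.assoc, f.star_hom, Category.assoc, g.star_hom,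
        Category.assoc], by
      rw [tensorMap_comp, Category.assoc, g.pairing_hom, f.pairing_hom]⟩

lemma hom_ext {X Y : IPVec U} {f g : X ⟶ Y} (H : f.hom = g.hom) : f = g := Hom.ext H

/-- Isomorphisms in `IPVec(U)` from isomorphisms of the underlying sheaves. -/
def isoMk {X Y : IPVec U} (e : X.sheaf ≅ Y.sheaf)
    (h₁ : X.star ≫ (conj U).map e.hom = e.hom ≫ Y.star)
    (h₂ : tensorMap e.hom e.hom ≫ Y.pairing = X.pairing) : X ≅ Y where
  hom := ⟨e.hom, h₁, h₂⟩
  inv := ⟨e.inv, by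
      rw [← cancel_epi e.hom, ← Category.assoc, ← h₁, Category.assoc, ← Functor.map_comp,
        e.hom_inv_id, CategoryTheory.Functor.map_id, Category.comp_id, ← Category.assoc, e.hom_inv_id,
        Category.id_comp], by
      rw [← h₂, ← Category.assoc, ← tensorMap_comp, e.inv_hom_id, tensorMap_id, Category.id_comp]⟩
  hom_inv_id := hom_ext e.hom_inv_id
  inv_hom_id := hom_ext e.inv_hom_id

/-- The pullback of an object of `IPVec`. -/
def pullbackObj (h : U ⟶ U') (X : IPVec U') : IPVec U where
  sheaf := (pullback h).obj X.sheaf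
  star := pullbackStar h X.star
  star_star := pullbackStar_star h X.star_star
  pairing := pullbackPairing h X.pairing
  symm := pullbackPairing_symm h X.symm
  star_pairing := pullbackStar_pairing h X.star_pairing

/-- The pullback functor of `IPVec`. -/
def pullbackFunctor (h : U ⟶ U') : IPVec U' ⥤ IPVec U where
  obj := pullbackObj h
  map {X Y} f := Hom.mk (X := pullbackObj h X) (Y := pullbackObj h Y) ((pullback h).map f.hom)
    (pullbackStar_map h f.star_hom) (pullbackPairing_map h f.pairing_hom)
  map_id X := hom_ext ((pullback h).map_id X.sheaf)
  map_comp f g := hom_ext ((pullback h).map_comp f.hom g.hom)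

/-- The coherence isomorphism for identities. -/
def pullbackIdIso (U : Man) : pullbackFunctor (𝟙 U) ≅ 𝟭 (IPVec U) :=
  NatIso.ofComponents (fun X => isoMk (X := pullbackObj (𝟙 U) X) (Y := X)
      ((pullbackId U).app X.sheaf) (idHom_star X.star) (idHom_pairing X.pairing))
    (fun f => hom_ext ((pullbackId U).hom.naturality f.hom))

/-- The coherence isomorphism for compositions. -/
def pullbackCompIso (h : U ⟶ U') (h' : U' ⟶ U'') :
    pullbackFunctor h' ⋙ pullbackFunctor h ≅ pullbackFunctor (h ≫ h') :=
  NatIso.ofComponents (fun X => isoMk (X := pullbackObj h (pullbackObj h' X))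
      (Y := pullbackObj (h ≫ h') X) ((pullbackComp h h').app X.sheaf)
      (compHom_star h h' X.star) (compHom_pairing h h' X.pairing))
    (fun f => hom_ext ((pullbackComp h h').hom.naturality f.hom))

end IPVec

section
variable {U₁ U₂ U₃ : Man}

lemma comp_assoc (h : U ⟶ U₁) (g : U₁ ⟶ U₂) (f : U₂ ⟶ U₃) (V : Sh U₃) :
    compInv h (g ≫ f) V ≫ (pullback h).map (compInv g f V) ≫ compHom h g ((pullback f).obj V) ≫
      compHom (h ≫ g) f V = 𝟙 _ :=
  pullback_ext (h ≫ g ≫ f) fun Ω v => by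
    rw [app_comp, app_comp, app_comp, compInv_eta, app_res, pullback_map_eta, compInv_eta, ← res_eta,
      res_res, app_res, compHom_eta, app_res, app_res, compHom_eta, res_res, res_res]
    exact res_refl _ _ _

lemma comp_left_unit (f : U ⟶ U₁) (V : Sh U₁) :
    compInv f (𝟙 U₁) V ≫ (pullback f).map (idHom V) = 𝟙 _ :=
  pullback_ext (f ≫ 𝟙 U₁) fun Ω v => by
    rw [app_comp, compInv_eta, app_res, pullback_map_eta, idHom_eta, ← res_eta, res_res]
    exact res_refl _ _ _

lemma comp_right_unit (f : U ⟶ U₁) (V : Sh U₁) :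
    compInv (𝟙 U) f V ≫ idHom ((pullback f).obj V) = 𝟙 _ :=
  pullback_ext (𝟙 U ≫ f) fun Ω v => by
    rw [app_comp, compInv_eta, app_res, idHom_eta, res_res]
    exact res_refl _ _ _

end

lemma cat_ext {C D : Type 1} [Category.{0} C] [Category.{0} D] {F G : C ⥤ D}
    {α β : F.toCatHom ⟶ G.toCatHom} (H : ∀ X, α.toNatTrans.app X = β.toNatTrans.app X) : α = β := by
  apply Cat.Hom₂.ext
  ext X
  exact H X

/-- The prestack `IPVec`: it assigns to a manifold `U` the category `IPVec U`, to a smooth map the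
pullback functor, with the canonical coherence isomorphisms of sheaves of modules. -/
def IPVecStack : Pseudofunctor (LocallyDiscrete Manᵒᵖ) Cat.{0, 1} :=
  LocallyDiscrete.mkPseudofunctor
    (fun U => Cat.of (IPVec U.unop))
    (fun h => (IPVec.pullbackFunctor h.unop).toCatHom)
    (fun U => Cat.Hom.isoMk (IPVec.pullbackIdIso U.unop))
    (fun h h' => Cat.Hom.isoMk (IPVec.pullbackCompIso h'.unop h.unop).symm)
    (by
      intro U₀ U₁ U₂ U₃ f g h
      apply cat_ext
      intro X
      apply IPVec.hom_ext
      refine Eq.trans ?_ (comp_assoc h.unop g.unop f.unop X.sheaf)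
      rfl)
    (by
      intro U₀ U₁ f
      apply cat_ext
      intro X
      apply IPVec.hom_ext
      refine Eq.trans ?_ (comp_left_unit f.unop X.sheaf)
      rfl)
    (by
      intro U₀ U₁ f
      apply cat_ext
      intro X
      apply IPVec.hom_ext
      refine Eq.trans ?_ (comp_right_unit f.unop X.sheaf)
      rfl)

/-! stacks -/

/-- An open subset of a manifold, as a manifold. -/
def ofOpens (U : Man) (W : Opens U.carrier) : Man where
  carrier := W
  dim := U.dim

/-- The inclusion of an open subset. -/
def incl (U : Man) (W : Opens U.carrier) : U.ofOpens W ⟶ U :=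
  (⟨Subtype.val, contMDiff_subtype_val⟩ :
    C^∞⟮𝓡 U.dim, (W : Opens U.carrier); 𝓡 U.dim, U.carrier⟯)

/-- A prestack on the category of manifolds, i.e. a pseudo-functor from the opposite of the category
of manifolds to categories, is a stack if for each manifold `U` and each open cover of `U` the
canonical functor from the category over `U` to the category of descent data for the cover is an
equivalence of categories. -/
def IsStack (X : Pseudofunctor (LocallyDiscrete Manᵒᵖ) Cat.{0, 1}) : Prop :=
  ∀ (U : Man) (ι : Type) (W : ι → Opens U.carrier), (⨆ i, W i = ⊤) →
    (X.toDescentData (fun i => U.incl (W i))).IsEquivalence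

end Man

end

/-!
The main point is that the pullback of sheaves of modules, defined as a left adjoint, is explicit
for the inclusion of an open subset `W`: the sections of the pullback over an open subset of `W`
are the sections of the original sheaf over its image (`pb_incl_surjective`, `pb_incl_inj`). Since
a morphism from a pullback is determined by its values on pullbacks of sections, everything can be
computed on sections, and the sheaf condition does the gluing.

*Objects.* Let `D` be a descent datum for a cover `W`. The glued sheaf `glueSh D` has as sections
over `Ω` the families of sections of the objects of `D` over the parts `Ω ∩ W i` that agree
(`Agree`), i.e. correspond to each other under the gluing morphisms after pullback to any manifold
over `W i` and `W j`. The gluing morphisms are compatible with the `*`-structures and the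
pairings; so the `*`-structure is defined on components, and the pairings of the components are
compatible functions, which glue to a function on `Ω`. The component at `i` defines a morphism
`glueHom` from the restriction of `glueSh D` to the given sheaf on `W i`. It is bijective on
sections (`glueHom_bijective`): over `Ω ⊆ W i` a section of the given sheaf extends uniquely to a
family, whose component at `j` is its image under the gluing morphism, and the components at `j`
and `k` agree by the cocycle condition.

*Morphisms.* A morphism is determined by its restrictions, as sections are determined by their
restrictions to `W i`. Given a morphism of descent data between the restrictions of two objects,
the images of the restrictions of a section agree on overlaps, and hence glue (`exists_image`);
this defines the morphism `glueMor`, which is compatible with the `*`-structures and the pairings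
because it is so on each `W i`. Here one needs that the gluing morphisms of the restrictions of an
object, which are composed of the coherence isomorphisms, map the pullback of a section to its
pullback (`restrHom_pb`).
-/

noncomputable section
namespace Man
variable {U U' U'' : Man}

/-! ### Sheaves of modules in terms of sections -/

/-- The underlying sheaf of abelian groups. -/
def abSheaf (V : Sh U) : TopCat.Sheaf Ab.{0} U.toTop :=
  ⟨(SheafOfModules.val V).presheaf, SheafOfModules.isSheaf V⟩

lemma exists_glue (V : Sh U) {κ : Type} {Ω : κ → Opens U.toTop} {Ω₀ : Opens U.toTop}
    (hle : ∀ k, Ω k ≤ Ω₀) (hcov : Ω₀ ≤ iSup Ω) (s : ∀ k, Sec V (Ω k))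
    (hs : ∀ k l, res V (inf_le_left : Ω k ⊓ Ω l ≤ Ω k) (s k) =
      res V (inf_le_right : Ω k ⊓ Ω l ≤ Ω l) (s l)) :
    ∃ t : Sec V Ω₀, ∀ k, res V (hle k) t = s k :=
  (TopCat.Sheaf.existsUnique_gluing' (abSheaf V) Ω Ω₀ (fun k => homOfLE (hle k)) hcov
    (fun k => show ToType ((abSheaf V).obj.obj (op (Ω k))) from s k) hs).exists

lemma sec_ext (V : Sh U) {κ : Type} {Ω : κ → Opens U.toTop} {Ω₀ : Opens U.toTop}
    (hle : ∀ k, Ω k ≤ Ω₀) (hcov : Ω₀ ≤ iSup Ω) {s t : Sec V Ω₀}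
    (h : ∀ k, res V (hle k) s = res V (hle k) t) : s = t :=
  TopCat.Sheaf.eq_of_locally_eq' (abSheaf V) Ω Ω₀ (fun k => homOfLE (hle k)) hcov s t h

section
variable (S : Opens U.toTop → Type) [∀ Ω, AddCommGroup (S Ω)] [∀ Ω, Module (U.Fun Ω) (S Ω)]
  (r : ∀ Ω Ω' : Opens U.toTop, Ω' ≤ Ω → S Ω →+ S Ω')

/-- The module of sections as an object of the category of modules over the ring of functions, in the
form in which the ring occurs in the definition of a presheaf of modules. -/
def secMod (X : (Opens U.toTop)ᵒᵖ) : ModuleCat.{0} (U.ringSheaf.obj.obj X) :=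
  ModuleCat.of (U.Fun X.unop) (S X.unop)

/-- A sheaf of modules from its modules of sections, its restriction maps, and the unique gluing
of compatible families. -/
def mkSh (r_refl : ∀ Ω s, r Ω Ω le_rfl s = s)
    (r_comp : ∀ Ω Ω' Ω'' (i : Ω' ≤ Ω) (j : Ω'' ≤ Ω') s,
      r Ω' Ω'' j (r Ω Ω' i s) = r Ω Ω'' (j.trans i) s)
    (r_smul : ∀ Ω Ω' (i : Ω' ≤ Ω) (a : U.Fun Ω) s, r Ω Ω' i (a • s) = resF i a • r Ω Ω' i s)
    (glue : ∀ (κ : Type) (Ω : κ → Opens U.toTop) (s : ∀ k, S (Ω k)),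
      (∀ k l, r _ (Ω k ⊓ Ω l) inf_le_left (s k) = r _ (Ω k ⊓ Ω l) inf_le_right (s l)) →
      ∃! t : S (iSup Ω), ∀ k, r _ _ (le_iSup Ω k) t = s k) : Sh U :=
  SheafOfModules.mk (R := U.ringSheaf)
    { obj X := secMod S X
      map {X Y} f := ModuleCat.ofHom (R := U.ringSheaf.obj.obj X) (X := secMod S X)
        (Y := (ModuleCat.restrictScalars (U.ringSheaf.obj.map f).hom).obj (secMod S Y))
        { toFun := r X.unop Y.unop f.unop.le
          map_add' := map_add _
          map_smul' := r_smul _ _ _ }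
      map_id X := by
        ext s
        exact r_refl _ s
      map_comp {X Y Z} f g := by
        ext s
        exact (r_comp _ _ _ _ _ s).symm }
    ((TopCat.Presheaf.isSheaf_iff_isSheafUniqueGluing _).2 fun κ Ω s h => by
      exact glue κ Ω s h)

end

/-! ### Open submanifolds -/

/-- A point of `W` as a point of the open submanifold. -/
def pt (W : Opens U.carrier) (x : U.carrier) (h : x ∈ W) : (U.ofOpens W).carrier :=
  (⟨x, h⟩ : W)

lemma isOpenEmbedding_incl (W : Opens U.carrier) : Topology.IsOpenEmbedding (U.incl W).1 :=
  W.isOpen.isOpenEmbedding_subtypeVal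

/-- The image in `U` of an open subset of the open submanifold `W`. -/
def im (W : Opens U.carrier) (Ω : Opens (U.ofOpens W).toTop) : Opens U.toTop :=
  ⟨(U.incl W).1 '' Ω.1, (isOpenEmbedding_incl W).isOpenMap _ Ω.isOpen⟩

lemma im_mono (W : Opens U.carrier) {Ω Ω' : Opens (U.ofOpens W).toTop} (i : Ω' ≤ Ω) :
    im W Ω' ≤ im W Ω := Set.image_mono i

lemma im_le (W : Opens U.carrier) (Ω : Opens (U.ofOpens W).toTop) : im W Ω ≤ W := by
  rintro _ ⟨x, _, rfl⟩
  exact x.2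

lemma pre_im (W : Opens U.carrier) (Ω : Opens (U.ofOpens W).toTop) :
    pre (U.incl W) (im W Ω) = Ω :=
  Opens.ext (Set.preimage_image_eq _ (isOpenEmbedding_incl W).injective)

lemma im_pre_le (W : Opens U.carrier) (Ω : Opens U.toTop) : im W (pre (U.incl W) Ω) ≤ Ω := by
  rintro _ ⟨x, hx, rfl⟩
  exact hx

/-- A smooth map whose image lies in the open subset `W`, as a map to `W`. -/
def codRestrict (q : U' ⟶ U) (W : Opens U.carrier) (h : ∀ x, q.1 x ∈ W) : U' ⟶ U.ofOpens W :=
  (⟨fun x => ⟨q.1 x, h x⟩, (ContMDiff.subtypeVal_comp_iff W _).1 q.2⟩ :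
    C^∞⟮𝓡 U'.dim, U'.carrier; 𝓡 U.dim, (W : Opens U.carrier)⟯)

lemma incl_cancel {W : Opens U.carrier} {f g : U' ⟶ U.ofOpens W}
    (h : f ≫ U.incl W = g ≫ U.incl W) : f = g :=
  ContMDiffMap.ext fun x => Subtype.ext (congrArg (fun k : U' ⟶ U => k.1 x) h)

lemma fun_ext {Ω : Opens U.toTop} {a b : U.Fun Ω} (h : ∀ x, a.1 x = b.1 x) : a = b :=
  Subtype.ext (funext h)

/-- A point of the image as point of the open submanifold. -/
def imPt (W : Opens U.carrier) (Ω : Opens (U.ofOpens W).toTop) (x : toOpens (im W Ω)) :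
    toOpens Ω :=
  ⟨pt W x.1 (im_le W Ω x.2), by obtain ⟨_, ⟨y, hy, rfl⟩⟩ := x; exact hy⟩

lemma contMDiff_imPt (W : Opens U.carrier) (Ω : Opens (U.ofOpens W).toTop) :
    ContMDiff (𝓡 U.dim) (𝓡 (U.ofOpens W).dim) ∞ (imPt W Ω) := by
  have h : ContMDiff (𝓡 U.dim) (𝓡 U.dim) ∞ fun x : toOpens (im W Ω) => (⟨x.1, im_le W Ω x.2⟩ : W) :=
    (ContMDiff.subtypeVal_comp_iff W _).1 contMDiff_subtype_val
  exact (ContMDiff.subtypeVal_comp_iff (toOpens Ω) _).1 h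

/-- Functions on an open subset of `W` as functions on the image. It is the inverse of `comapF` for the
inclusion. -/
def imF (W : Opens U.carrier) (Ω : Opens (U.ofOpens W).toTop) :
    (U.ofOpens W).Fun Ω →+* U.Fun (im W Ω) where
  toFun a := show C^∞⟮𝓡 U.dim, (toOpens (im W Ω)); 𝓘(ℝ, ℂ), ℂ⟯ from
    ⟨fun x => a.1 (imPt W Ω x), ContMDiff.comp (I' := 𝓡 (U.ofOpens W).dim) a.2 (contMDiff_imPt W Ω)⟩
  map_one' := rfl
  map_zero' := rfl
  map_mul' _ _ := rfl
  map_add' _ _ := rfl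

section
variable (W : Opens U.carrier) (V : Sh U)

instance (Ω : Opens (U.ofOpens W).toTop) : Module ((U.ofOpens W).Fun Ω) (Sec V (im W Ω)) :=
  Module.compHom _ (imF W Ω)

lemma imF_smul {Ω : Opens (U.ofOpens W).toTop} (a : (U.ofOpens W).Fun Ω) (v : Sec V (im W Ω)) :
    a • v = imF W Ω a • v := rfl

lemma im_inf_le (W : Opens U.carrier) (Ω Ω' : Opens (U.ofOpens W).toTop) :
    im W Ω ⊓ im W Ω' ≤ im W (Ω ⊓ Ω') := fun x hx =>
  ⟨pt W x (im_le W Ω hx.1), ⟨(imPt W Ω ⟨x, hx.1⟩).2, (imPt W Ω' ⟨x, hx.2⟩).2⟩, rfl⟩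

lemma im_iSup_le (W : Opens U.carrier) {κ : Type} (Ω : κ → Opens (U.ofOpens W).toTop) :
    im W (iSup Ω) ≤ ⨆ k, im W (Ω k) := by
  rintro _ ⟨y, hy, rfl⟩
  obtain ⟨k, hk⟩ := Opens.mem_iSup.1 hy
  exact Opens.mem_iSup.2 ⟨k, y, hk, rfl⟩

/-- The restriction of a sheaf of modules to an open submanifold: its sections over `Ω` are the
sections over the image of `Ω`. -/
def restr : Sh (U.ofOpens W) :=
  mkSh (fun Ω => Sec V (im W Ω)) (fun Ω Ω' i => res V (im_mono W i))
    (fun _ _ => res_refl _ _ _) (fun _ _ _ _ _ _ => res_res _ _ _ _)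
    (fun Ω Ω' i a v => by
      rw [imF_smul, res_smul]
      rfl)
    (fun κ Ω s h => by
      have hle := fun k => im_mono W (le_iSup Ω k)
      refine existsUnique_of_exists_of_unique ?_ fun t t' ht ht' =>
        sec_ext V hle (im_iSup_le W Ω) fun k => (ht k).trans (ht' k).symm
      refine exists_glue V hle (im_iSup_le W Ω) s fun k l => ?_
      have := congrArg (res V (im_inf_le W _ _)) (h k l)
      rwa [res_res, res_res] at this)

/-- A section of `V` over the image as section of the restriction. -/
def toRes (Ω : Opens (U.ofOpens W).toTop) : Sec V (im W Ω) ≃+ Sec (restr W V) Ω := AddEquiv.refl _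

lemma toRes_smul {Ω : Opens (U.ofOpens W).toTop} (a : (U.ofOpens W).Fun Ω) (v : Sec V (im W Ω)) :
    toRes W V Ω (imF W Ω a • v) = a • toRes W V Ω v := rfl

lemma res_toRes {Ω Ω' : Opens (U.ofOpens W).toTop} (i : Ω' ≤ Ω) (v : Sec V (im W Ω)) :
    res (restr W V) i (toRes W V Ω v) = toRes W V Ω' (res V (im_mono W i) v) := rfl

/-- The canonical morphism from the pullback along an open embedding to the restriction. Together with
`fromRestr` it makes the sections of the abstractly defined pullback explicit. -/
def toRestr : (pullback (U.incl W)).obj V ⟶ restr W V :=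
  extend (U.incl W)
    (mkHom (fun Ω v => toPf _ (restr W V) Ω (toRes W V _ (res V (im_pre_le W Ω) v)))
      (by simp)
      (fun Ω a v => by
        rw [res_smul, ← toPf_smul, ← toRes_smul]
        rfl)
      (fun Ω Ω' i v => by rw [res_toPf, res_toRes, res_res, res_res]))

variable {V}

lemma toRestr_eta {Ω : Opens U.toTop} (v : Sec V Ω) :
    app (toRestr W V) _ (eta (U.incl W) v) = toRes W V _ (res V (im_pre_le W Ω) v) := by
  rw [toRestr, extend_eta, app_mkHom, AddEquiv.symm_apply_apply]

/-- The canonical morphism from the restriction to the pullback. -/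
def fromRestr : restr W V ⟶ (pullback (U.incl W)).obj V :=
  mkHom (fun Ω v => res _ (pre_im W Ω).ge (eta (U.incl W) ((toRes W V Ω).symm v)))
    (by simp [eta_add])
    (fun Ω a v => by
      obtain ⟨v, rfl⟩ := (toRes W V Ω).surjective v
      rw [← toRes_smul, AddEquiv.symm_apply_apply, AddEquiv.symm_apply_apply, eta_smul, res_smul]
      rfl)
    (fun Ω Ω' i v => by
      obtain ⟨v, rfl⟩ := (toRes W V Ω).surjective v
      rw [res_toRes, AddEquiv.symm_apply_apply, AddEquiv.symm_apply_apply, ← res_eta, res_res,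
        res_res])

lemma fromRestr_toRes {Ω : Opens (U.ofOpens W).toTop} (v : Sec V (im W Ω)) :
    app (fromRestr W) Ω (toRes W V Ω v) = res _ (pre_im W Ω).ge (eta (U.incl W) v) := rfl

/-- Only this composite is needed: both maps are then controlled by their values on the sections
`eta v`, which generate the pullback. -/
lemma toRestr_fromRestr : toRestr W V ≫ fromRestr W = 𝟙 _ :=
  pullback_ext (U.incl W) fun Ω v => by
    rw [app_comp, toRestr_eta, fromRestr_toRes, ← res_eta, res_res, res_refl, app_id]

/-! ### Pullbacks of sections -/

/-- The pullback of a section, restricted to an open subset of the preimage. -/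
def pb (f : U ⟶ U') {V : Sh U'} {Ω : Opens U'.toTop} (v : Sec V Ω) (Z : Opens U.toTop)
    (h : Z ≤ pre f Ω) : Sec ((pullback f).obj V) Z :=
  res _ h (eta f v)

section
variable (f : U ⟶ U') {V : Sh U'} {Ω Ω' : Opens U'.toTop} (v : Sec V Ω) {Z Z' : Opens U.toTop}

lemma eta_eq_pb : eta f v = pb f v (pre f Ω) le_rfl := (res_refl _ _ _).symm

lemma res_pb (h : Z ≤ pre f Ω) (i : Z' ≤ Z) : res _ i (pb f v Z h) = pb f v Z' (i.trans h) :=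
  res_res _ _ _ _

lemma pb_res (i : Ω' ≤ Ω) (h : Z ≤ pre f Ω') :
    pb f (res V i v) Z h = pb f v Z (h.trans (pre_mono f i)) := by
  rw [pb, ← res_eta, res_res, pb]

lemma map_pb {V' : Sh U'} (k : V ⟶ V') (h : Z ≤ pre f Ω) :
    app ((pullback f).map k) Z (pb f v Z h) = pb f (app k Ω v) Z h := by
  rw [pb, app_res, pullback_map_eta, pb]

end

/-- Every section of the pullback to an open submanifold is the pullback of a section over the
image. -/
lemma pb_incl_surjective {Z : Opens (U.ofOpens W).toTop}
    (a : Sec ((pullback (U.incl W)).obj V) Z) :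
    ∃ v : Sec V (im W Z), pb (U.incl W) v Z (pre_im W Z).ge = a :=
  ⟨(toRes W V Z).symm (app (toRestr W V) Z a), app_comm (toRestr_fromRestr W) a⟩

/-- Sections with the same pullback to an open submanifold agree on the image of the open subset on
which the pullbacks are compared. -/
lemma pb_incl_inj {Ω Ω' : Opens U.toTop} {v : Sec V Ω} {v' : Sec V Ω'}
    {Z : Opens (U.ofOpens W).toTop} (h : Z ≤ pre (U.incl W) Ω) (h' : Z ≤ pre (U.incl W) Ω')
    (H : pb (U.incl W) v Z h = pb (U.incl W) v' Z h') {X : Opens U.toTop} (hX : X ≤ im W Z)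
    (i : X ≤ Ω) (i' : X ≤ Ω') : res V i v = res V i' v' := by
  have := congrArg (app (toRestr W V) Z) H
  rw [pb, pb, app_res, app_res, toRestr_eta, toRestr_eta, res_toRes, res_toRes] at this
  have := congrArg (res V hX) ((toRes W V Z).injective this)
  rwa [res_res, res_res, res_res, res_res] at this

end

lemma compHom_pb (g : U ⟶ U') (f : U' ⟶ U'') {V : Sh U''} {Ω : Opens U''.toTop} (v : Sec V Ω)
    {Z' : Opens U'.toTop} (h' : Z' ≤ pre f Ω) {Z : Opens U.toTop} (h : Z ≤ pre g Z') :
    app (compHom g f V) Z (pb g (pb f v Z' h') Z h) =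
      pb (g ≫ f) v Z (h.trans (pre_mono g h')) := by
  rw [pb, pb, ← res_eta, res_res, app_res, compHom_eta, res_res]
  rfl

lemma compInv_pb (g : U ⟶ U') (f : U' ⟶ U'') {V : Sh U''} {Ω : Opens U''.toTop} (v : Sec V Ω)
    {Z' : Opens U'.toTop} (h' : Z' ≤ pre f Ω) {Z : Opens U.toTop} (h : Z ≤ pre g Z') :
    app (compInv g f V) Z (pb (g ≫ f) v Z (h.trans (pre_mono g h'))) =
      pb g (pb f v Z' h') Z h := by
  rw [pb, pb, pb, ← res_eta, res_res, app_res, compInv_eta, res_res]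

/-! ### Descent data on sections -/

section
variable {ι : Type} {W : ι → Opens U.carrier}
  (D : IPVecStack.DescentData (fun i => U.incl (W i))) {Y Y' : Man} {i j k : ι}

/-- The objects of a descent datum. -/
def dObj (i : ι) : IPVec (U.ofOpens (W i)) := D.obj i

/-- The sheaves of modules of a descent datum. -/
abbrev dSh (i : ι) : Sh (U.ofOpens (W i)) := (dObj D i).sheaf

/-- The gluing morphisms of a descent datum. The composite to `U`, a separate argument of
`DescentData.hom`, is taken to be `f₁ ≫ U.incl (W i)`. -/
def dMor (f₁ : Y ⟶ U.ofOpens (W i)) (f₂ : Y ⟶ U.ofOpens (W j))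
    (h : f₁ ≫ U.incl (W i) = f₂ ≫ U.incl (W j)) :
    IPVec.pullbackObj f₁ (dObj D i) ⟶ IPVec.pullbackObj f₂ (dObj D j) :=
  D.hom (f₁ ≫ U.incl (W i)) f₁ f₂ rfl h.symm

/-- The gluing morphisms of a descent datum, as morphisms of sheaves of modules. -/
def dHom (f₁ : Y ⟶ U.ofOpens (W i)) (f₂ : Y ⟶ U.ofOpens (W j))
    (h : f₁ ≫ U.incl (W i) = f₂ ≫ U.incl (W j)) :
    (pullback f₁).obj (dSh D i) ⟶ (pullback f₂).obj (dSh D j) :=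
  (dMor D f₁ f₂ h).hom

lemma dHom_self (f : Y ⟶ U.ofOpens (W i)) : dHom D f f rfl = 𝟙 _ :=
  congrArg IPVec.Hom.hom (D.hom_self (f ≫ U.incl (W i)) f rfl)

lemma dHom_comp (f₁ : Y ⟶ U.ofOpens (W i)) (f₂ : Y ⟶ U.ofOpens (W j)) (f₃ : Y ⟶ U.ofOpens (W k))
    (h : f₁ ≫ U.incl (W i) = f₂ ≫ U.incl (W j)) (h' : f₂ ≫ U.incl (W j) = f₃ ≫ U.incl (W k)) :
    dHom D f₁ f₂ h ≫ dHom D f₂ f₃ h' = dHom D f₁ f₃ (h.trans h') := by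
  have := congrArg IPVec.Hom.hom (D.hom_comp (f₁ ≫ U.incl (W i)) f₁ f₂ f₃ rfl h.symm
    (h.trans h').symm)
  refine Eq.trans ?_ this
  have e : ∀ q (hq : f₂ ≫ U.incl (W j) = q) (hq' : f₃ ≫ U.incl (W k) = q),
      dHom D f₂ f₃ h' = IPVec.Hom.hom (D.hom q f₂ f₃ hq hq') := by
    rintro q rfl hq'
    rfl
  rw [e _ h.symm (h.trans h').symm]
  rfl

/-- The gluing morphisms are compatible with pullback, up to the coherence isomorphisms. -/
lemma dHom_pull (g : Y' ⟶ Y) (f₁ : Y ⟶ U.ofOpens (W i)) (f₂ : Y ⟶ U.ofOpens (W j))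
    (h : f₁ ≫ U.incl (W i) = f₂ ≫ U.incl (W j))
    (h' : (g ≫ f₁) ≫ U.incl (W i) = (g ≫ f₂) ≫ U.incl (W j)) :
    dHom D (g ≫ f₁) (g ≫ f₂) h' =
      compInv g f₁ _ ≫ (pullback g).map (dHom D f₁ f₂ h) ≫ compHom g f₂ _ := by
  refine (congrArg IPVec.Hom.hom (D.pullHom_hom g (f₁ ≫ U.incl (W i)) ((g ≫ f₁) ≫ U.incl (W i))
    (Category.assoc _ _ _).symm f₁ f₂ rfl h.symm (g ≫ f₁) (g ≫ f₂) rfl rfl)).symm.trans ?_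
  have e : ∀ {l} (f : Y ⟶ U.ofOpens (W l)), IPVecStack.mapComp' f.op.toLoc g.op.toLoc
      (g ≫ f).op.toLoc rfl = IPVecStack.mapComp f.op.toLoc g.op.toLoc :=
    fun f => Pseudofunctor.mapComp'_eq_mapComp _ _ _
  rw [Pseudofunctor.LocallyDiscreteOpToCat.pullHom, e, e]
  rfl

end

section
variable (f : U ⟶ U') {V : Sh U'} {Ω : Opens U'.toTop} {Z : Opens U.toTop}

lemma pb_add (v v' : Sec V Ω) (h : Z ≤ pre f Ω) : pb f (v + v') Z h = pb f v Z h + pb f v' Z h := by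
  rw [pb, eta_add, map_add, pb, pb]

lemma pb_zero (h : Z ≤ pre f Ω) : pb f (0 : Sec V Ω) Z h = 0 := by
  have := pb_add f (0 : Sec V Ω) 0 h
  rwa [add_zero, left_eq_add] at this

lemma pb_smul (a : U'.Fun Ω) (v : Sec V Ω) (h : Z ≤ pre f Ω) :
    pb f (a • v) Z h = resF h (comapF f Ω a) • pb f v Z h := by
  rw [pb, eta_smul, res_smul, pb]

lemma st_pb (s : V ⟶ (conj U').obj V) (v : Sec V Ω) (h : Z ≤ pre f Ω) :
    st (pullbackStar f s) (pb f v Z h) = pb f (st s v) Z h := by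
  rw [pb, ← res_st, st_eta, pb]

lemma ip_pb (p : tensor V V ⟶ unit U') (v w : Sec V Ω) (h : Z ≤ pre f Ω) :
    ip (pullbackPairing f p) (pb f v Z h) (pb f w Z h) = resF h (comapF f Ω (ip p v w)) := by
  rw [pb, pb, ← res_ip, ip_eta]

end

lemma pre_eq_of_comp {Y U₁ U₂ : Man} {f₁ : Y ⟶ U₁} {f₂ : Y ⟶ U₂} {q₁ : U₁ ⟶ U} {q₂ : U₂ ⟶ U}
    (h : f₁ ≫ q₁ = f₂ ≫ q₂) (Ω : Opens U.toTop) : pre f₁ (pre q₁ Ω) = pre f₂ (pre q₂ Ω) := by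
  change pre (f₁ ≫ q₁) Ω = pre (f₂ ≫ q₂) Ω
  rw [h]

/-! ### Agreeing sections of a descent datum -/

section
variable {ι : Type} {W : ι → Opens U.carrier}
  (D : IPVecStack.DescentData (fun i => U.incl (W i))) {Y Y' : Man} {i j k : ι}

/-- Sections of the objects of a descent datum over the open submanifolds `W i` and `W j`
agree on the open subset `Z` of `Y` if the gluing morphism maps the pullback to `Z` of the first
to that of the second. -/
def Agree {f₁ : Y ⟶ U.ofOpens (W i)} {f₂ : Y ⟶ U.ofOpens (W j)}
    (h : f₁ ≫ U.incl (W i) = f₂ ≫ U.incl (W j)) {Ω₁ Ω₂} (s : Sec (dSh D i) Ω₁) (t : Sec (dSh D j) Ω₂)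
    (Z : Opens Y.toTop) (h₁ : Z ≤ pre f₁ Ω₁) (h₂ : Z ≤ pre f₂ Ω₂) : Prop :=
  app (dHom D f₁ f₂ h) Z (pb f₁ s Z h₁) = pb f₂ t Z h₂

variable {D} {f₁ : Y ⟶ U.ofOpens (W i)} {f₂ : Y ⟶ U.ofOpens (W j)} {f₃ : Y ⟶ U.ofOpens (W k)}
  {h : f₁ ≫ U.incl (W i) = f₂ ≫ U.incl (W j)} {h' : f₂ ≫ U.incl (W j) = f₃ ≫ U.incl (W k)}
  {Ω₁ Ω₂ Ω₃} {s : Sec (dSh D i) Ω₁} {t : Sec (dSh D j) Ω₂} {u : Sec (dSh D k) Ω₃}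
  {Z : Opens Y.toTop} {h₁ : Z ≤ pre f₁ Ω₁} {h₂ : Z ≤ pre f₂ Ω₂} {h₃ : Z ≤ pre f₃ Ω₃}

namespace Agree

lemma refl (h₁ : Z ≤ pre f₁ Ω₁) : Agree D rfl s s Z h₁ h₁ := by
  rw [Agree, dHom_self]
  rfl

lemma trans (H : Agree D h s t Z h₁ h₂) (H' : Agree D h' t u Z h₂ h₃) :
    Agree D (h.trans h') s u Z h₁ h₃ := by
  rw [Agree, ← dHom_comp D f₁ f₂ f₃ h h', app_comp, H, H']

/-- The gluing morphism for `(j, i)` is inverse to that for `(i, j)`, by the cocycle condition. -/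
lemma symm (H : Agree D h s t Z h₁ h₂) : Agree D h.symm t s Z h₂ h₁ := by
  rw [Agree, ← H, ← app_comp, dHom_comp, dHom_self, app_id]

lemma pull (H : Agree D h s t Z h₁ h₂) (g : Y' ⟶ Y)
    (h' : (g ≫ f₁) ≫ U.incl (W i) = (g ≫ f₂) ≫ U.incl (W j)) {Z' : Opens Y'.toTop}
    (hZ : Z' ≤ pre g Z) :
    Agree D h' s t Z' (hZ.trans (pre_mono g h₁)) (hZ.trans (pre_mono g h₂)) := by
  rw [Agree, dHom_pull D g f₁ f₂ h h', app_comp, app_comp, compInv_pb g f₁ s h₁ hZ, map_pb, H,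
    compHom_pb]

/-- Agreement on `Z` may be checked after pullback to the open submanifold `Z`. This holds since the
pullback to `Z` is injective on sections over `Z`. -/
lemma of_incl {h' : (Y.incl (toOpens Z) ≫ f₁) ≫ U.incl (W i) =
      (Y.incl (toOpens Z) ≫ f₂) ≫ U.incl (W j)}
    {h₁' : ⊤ ≤ pre (Y.incl (toOpens Z) ≫ f₁) Ω₁} {h₂' : ⊤ ≤ pre (Y.incl (toOpens Z) ≫ f₂) Ω₂}
    (H : Agree D h' s t ⊤ h₁' h₂') : Agree D h s t Z h₁ h₂ := by
  have hZ : ⊤ ≤ pre (Y.incl (toOpens Z)) Z := fun x _ => x.2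
  rw [Agree, dHom_pull D (Y.incl (toOpens Z)) f₁ f₂ h h', app_comp, app_comp,
    compInv_pb _ f₁ s h₁ hZ, map_pb, ← compHom_pb _ _ t h₂ hZ] at H
  -- `compHom` is injective, with inverse `compInv`
  have H' := congrArg (app (compInv (Y.incl (toOpens Z)) f₂ _) ⊤) H
  rw [← app_comp, ← app_comp] at H'
  have e := ((pullbackComp (Y.incl (toOpens Z)) f₂).app (dSh D j)).hom_inv_id
  change compHom (Y.incl (toOpens Z)) f₂ (dSh D j) ≫
    compInv (Y.incl (toOpens Z)) f₂ (dSh D j) = 𝟙 _ at e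
  rw [e, app_id, app_id] at H'
  have := pb_incl_inj (toOpens Z) hZ hZ H' (X := Z)
    (fun x hx => ⟨pt (toOpens Z) x hx, trivial, rfl⟩) le_rfl le_rfl
  rwa [res_refl, res_refl] at this

lemma of_locally {κ : Type} (X : κ → Opens Y.toTop) (hle : ∀ k, X k ≤ Z) (hcov : Z ≤ iSup X)
    (H : ∀ k, Agree D h s t (X k) ((hle k).trans h₁) ((hle k).trans h₂)) :
    Agree D h s t Z h₁ h₂ := by
  refine sec_ext _ hle hcov fun k => ?_
  rw [← app_res, res_pb, res_pb]
  exact H k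

lemma add {s' : Sec (dSh D i) Ω₁} {t' : Sec (dSh D j) Ω₂} (H : Agree D h s t Z h₁ h₂)
    (H' : Agree D h s' t' Z h₁ h₂) : Agree D h (s + s') (t + t') Z h₁ h₂ := by
  rw [Agree, pb_add, pb_add, map_add, H, H']

lemma zero : Agree D h (0 : Sec (dSh D i) Ω₁) (0 : Sec (dSh D j) Ω₂) Z h₁ h₂ := by
  rw [Agree, pb_zero, pb_zero, map_zero]

lemma smul {a : (U.ofOpens (W i)).Fun Ω₁} {b : (U.ofOpens (W j)).Fun Ω₂}
    (H : Agree D h s t Z h₁ h₂) (e : resF h₁ (comapF f₁ Ω₁ a) = resF h₂ (comapF f₂ Ω₂ b)) :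
    Agree D h (a • s) (b • t) Z h₁ h₂ := by
  rw [Agree, pb_smul, pb_smul, map_smul, H, e]

lemma of_res {Ω₁' Ω₂'} {i₁ : Ω₁' ≤ Ω₁} {i₂ : Ω₂' ≤ Ω₂} {h₁ : Z ≤ pre f₁ Ω₁'} {h₂ : Z ≤ pre f₂ Ω₂'}
    (H : Agree D h s t Z (h₁.trans (pre_mono _ i₁)) (h₂.trans (pre_mono _ i₂))) :
    Agree D h (res _ i₁ s) (res _ i₂ t) Z h₁ h₂ := by
  rw [Agree, pb_res, pb_res]
  exact H

lemma of_res' {Ω₁' Ω₂'} {i₁ : Ω₁' ≤ Ω₁} {i₂ : Ω₂' ≤ Ω₂} {h₁' : Z ≤ pre f₁ Ω₁'}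
    {h₂' : Z ≤ pre f₂ Ω₂'}
    (H : Agree D h (res _ i₁ s) (res _ i₂ t) Z h₁' h₂') : Agree D h s t Z h₁ h₂ := by
  rw [Agree, pb_res, pb_res] at H
  exact H

lemma star (H : Agree D h s t Z h₁ h₂) :
    Agree D h (st (dObj D i).star s) (st (dObj D j).star t) Z h₁ h₂ := by
  rw [Agree, ← st_pb, ← st_pb, ← H]
  exact st_conj_map.1 (app_comm (dMor D f₁ f₂ h).star_hom _)

lemma pairing {s' : Sec (dSh D i) Ω₁} {t' : Sec (dSh D j) Ω₂} (H : Agree D h s t Z h₁ h₂)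
    (H' : Agree D h s' t' Z h₁ h₂) :
    resF h₁ (comapF f₁ Ω₁ (ip (dObj D i).pairing s s')) =
      resF h₂ (comapF f₂ Ω₂ (ip (dObj D j).pairing t t')) := by
  have e := ip_map.1 (app_comm (dMor D f₁ f₂ h).pairing_hom (tmul (pb f₁ s Z h₁) (pb f₁ s' Z h₁)))
  change ip (pullbackPairing f₂ (dObj D j).pairing) (app (dHom D f₁ f₂ h) Z _)
    (app (dHom D f₁ f₂ h) Z _) = _ at e
  rw [H, H'] at e
  refine (ip_pb f₁ _ _ _ _).symm.trans (e.symm.trans (ip_pb f₂ _ _ _ _))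

end Agree

variable (D)

/-! ### The glued sheaf -/

/-- The families of sections of the objects of a descent datum over the parts of `Ω` that agree.
Agreement is asked for on all manifolds `Y` over `W i` and `W j`, in the form in which the gluing
morphisms of `DescentData` are given; the overlap of `W i` and `W j` would suffice. The factors are
written as sections of pushforwards, so that the functions on `Ω` act. -/
def glueSec (Ω : Opens U.toTop) :
    Submodule (U.Fun Ω) (∀ i, Sec ((pushforward (U.incl (W i))).obj (dSh D i)) Ω) where
  carrier := {s | ∀ (Y : Man) (i j : ι) (f₁ : Y ⟶ U.ofOpens (W i)) (f₂ : Y ⟶ U.ofOpens (W j))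
    (h : f₁ ≫ U.incl (W i) = f₂ ≫ U.incl (W j)) (Z : Opens Y.toTop)
    (h₁ : Z ≤ pre f₁ (pre (U.incl (W i)) Ω)) (h₂ : Z ≤ pre f₂ (pre (U.incl (W j)) Ω)),
    Agree D h ((toPf _ _ Ω).symm (s i)) ((toPf _ _ Ω).symm (s j)) Z h₁ h₂}
  add_mem' H H' Y i j f₁ f₂ h Z h₁ h₂ := (H Y i j f₁ f₂ h Z h₁ h₂).add (H' Y i j f₁ f₂ h Z h₁ h₂)
  zero_mem' Y i j f₁ f₂ h Z h₁ h₂ := Agree.zero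
  smul_mem' a s H Y i j f₁ f₂ h Z h₁ h₂ := by
    refine (H Y i j f₁ f₂ h Z h₁ h₂).smul (a := comapF _ Ω a) (b := comapF _ Ω a) ?_
    exact fun_ext fun x => congrArg a.1
      (Subtype.ext (congrArg (fun k : Y ⟶ U => k.1 x.1) h))

variable {D}

/-- The component of a family. -/
def comp {Ω : Opens U.toTop} (s : glueSec D Ω) (i : ι) : Sec (dSh D i) (pre (U.incl (W i)) Ω) :=
  (toPf _ _ Ω).symm (s.1 i)

lemma glueSec_ext {Ω : Opens U.toTop} {s t : glueSec D Ω} (h : ∀ i, comp s i = comp t i) : s = t :=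
  Subtype.ext (funext h)

lemma agree_comp {Ω : Opens U.toTop} (s : glueSec D Ω) (h : f₁ ≫ U.incl (W i) = f₂ ≫ U.incl (W j))
    (h₁ : Z ≤ pre f₁ (pre (U.incl (W i)) Ω)) (h₂ : Z ≤ pre f₂ (pre (U.incl (W j)) Ω)) :
    Agree D h (comp s i) (comp s j) Z h₁ h₂ := s.2 Y i j f₁ f₂ h Z h₁ h₂

/-- A family of agreeing sections. -/
def mkSec {Ω : Opens U.toTop} (s : ∀ i, Sec (dSh D i) (pre (U.incl (W i)) Ω))
    (H : ∀ (Y : Man) (i j : ι) (f₁ : Y ⟶ U.ofOpens (W i)) (f₂ : Y ⟶ U.ofOpens (W j))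
      (h : f₁ ≫ U.incl (W i) = f₂ ≫ U.incl (W j)) (Z : Opens Y.toTop)
      (h₁ : Z ≤ pre f₁ (pre (U.incl (W i)) Ω)) (h₂ : Z ≤ pre f₂ (pre (U.incl (W j)) Ω)),
      Agree D h (s i) (s j) Z h₁ h₂) : glueSec D Ω :=
  ⟨fun i => toPf _ _ Ω (s i), H⟩

lemma comp_mkSec {Ω : Opens U.toTop} (s : ∀ i, Sec (dSh D i) (pre (U.incl (W i)) Ω)) (H) (i : ι) :
    comp (mkSec s H) i = s i := rfl

lemma comp_smul {Ω : Opens U.toTop} (a : U.Fun Ω) (s : glueSec D Ω) (i : ι) :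
    comp (a • s) i = comapF (U.incl (W i)) Ω a • comp s i := rfl

variable (D)

/-- Restriction of families. -/
def glueRes (Ω Ω' : Opens U.toTop) (i : Ω' ≤ Ω) : glueSec D Ω →+ glueSec D Ω' :=
  AddMonoidHom.mk' (fun s => mkSec (fun k => res _ (pre_mono _ i) (comp s k))
      fun Y j k f₁ f₂ h Z h₁ h₂ => (agree_comp s h _ _).of_res)
    (fun s t => glueSec_ext fun k => by rw [comp_mkSec]; exact map_add _ _ _)

variable {D}

lemma comp_glueRes {Ω Ω' : Opens U.toTop} (i : Ω' ≤ Ω) (s : glueSec D Ω) (k : ι) :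
    comp (glueRes D Ω Ω' i s) k = res _ (pre_mono _ i) (comp s k) := rfl

lemma pre_iSup_le (f : U ⟶ U') {κ : Type} (Ω : κ → Opens U'.toTop) :
    pre f (iSup Ω) ≤ ⨆ k, pre f (Ω k) := fun x hx => by
  obtain ⟨k, hk⟩ := Opens.mem_iSup.1 hx
  exact Opens.mem_iSup.2 ⟨k, hk⟩

variable (D)

/-- The sheaf of modules obtained by gluing the sheaves of a descent datum. -/
def glueSh : Sh U :=
  mkSh (fun Ω => glueSec D Ω) (glueRes D)
    (fun _ s => glueSec_ext fun i => by rw [comp_glueRes, res_refl])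
    (fun _ _ _ _ _ s => glueSec_ext fun i => by
      rw [comp_glueRes, comp_glueRes, comp_glueRes, res_res])
    (fun _ _ _ a s => glueSec_ext fun i => by
      rw [comp_glueRes, comp_smul, comp_smul, comp_glueRes, res_smul, resF_comapF])
    (fun κ Ω s H => by
      have hle : ∀ i k, pre (U.incl (W i)) (Ω k) ≤ pre (U.incl (W i)) (iSup Ω) :=
        fun i k => pre_mono _ (le_iSup Ω k)
      have hcov : ∀ i, pre (U.incl (W i)) (iSup Ω) ≤ ⨆ k, pre (U.incl (W i)) (Ω k) :=
        fun i => pre_iSup_le _ _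
      have key : ∀ i, ∃ t : Sec (dSh D i) (pre (U.incl (W i)) (iSup Ω)),
          ∀ k, res _ (hle i k) t = comp (s k) i := fun i =>
        exists_glue _ (hle i) (hcov i) (fun k => comp (s k) i) fun k l =>
          congrArg (fun a => comp a i) (H k l)
      choose t ht using key
      -- the components glue one by one, and agreement of the glued components is local
      refine existsUnique_of_exists_of_unique ⟨mkSec t ?_, fun k => glueSec_ext fun i => ht i k⟩
        fun a b ha hb => glueSec_ext fun i => sec_ext _ (hle i) (hcov i) fun k =>
          congrArg (fun c => comp c i) ((ha k).trans (hb k).symm)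
      intro Y i j f₁ f₂ h Z h₁ h₂
      refine Agree.of_locally (fun k => Z ⊓ pre f₁ (pre (U.incl (W i)) (Ω k))) (fun k => inf_le_left)
        (fun x hx => ?_) fun k => ?_
      · obtain ⟨k, hk⟩ := Opens.mem_iSup.1 (hcov i (h₁ hx))
        exact Opens.mem_iSup.2 ⟨k, hx, hk⟩
      · have := agree_comp (s k) h (inf_le_right : Z ⊓ pre f₁ (pre (U.incl (W i)) (Ω k)) ≤ _)
          (inf_le_right.trans (pre_eq_of_comp h _).le)
        rw [← ht i k, ← ht j k] at this
        exact this.of_res')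

end

/-! ### The `*`-structure and the pairing of the glued sheaf -/

section
variable {V : Sh U} {Ω : Opens U.toTop}

lemma st_add (s : V ⟶ (conj U).obj V) (v w : Sec V Ω) : st s (v + w) = st s v + st s w := by
  rw [st, map_add, map_add, st, st]

lemma st_smul (s : V ⟶ (conj U).obj V) (a : U.Fun Ω) (v : Sec V Ω) :
    st s (a • v) = conjF Ω a • st s v := by
  rw [st, map_smul, toConj_symm_smul, st]

lemma ip_add_left (p : tensor V V ⟶ unit U) (v v' w : Sec V Ω) :
    ip p (v + v') w = ip p v w + ip p v' w := by
  rw [ip, add_tmul, map_add, map_add, ip, ip]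

lemma ip_add_right (p : tensor V V ⟶ unit U) (v w w' : Sec V Ω) :
    ip p v (w + w') = ip p v w + ip p v w' := by
  rw [ip, tmul_add, map_add, map_add, ip, ip]

lemma ip_smul_left (p : tensor V V ⟶ unit U) (a : U.Fun Ω) (v w : Sec V Ω) :
    ip p (a • v) w = a * ip p v w := by
  apply (toUnit Ω).injective
  rw [← smul_toUnit, ← app_pairing, ← app_pairing, smul_tmul, map_smul]

lemma ip_smul_right (p : tensor V V ⟶ unit U) (a : U.Fun Ω) (v w : Sec V Ω) :
    ip p v (a • w) = a * ip p v w := by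
  apply (toUnit Ω).injective
  rw [← smul_toUnit, ← app_pairing, ← app_pairing, tmul_smul, map_smul]

end

section
variable {ι : Type} {W : ι → Opens U.carrier}

lemma exists_mem (hW : ⨆ i, W i = ⊤) (x : U.carrier) : ∃ i, x ∈ W i :=
  Opens.mem_iSup.1 (hW ▸ Opens.mem_top x)

lemma fun_ext_cover (hW : ⨆ i, W i = ⊤) {Ω : Opens U.toTop} {a b : U.Fun Ω}
    (H : ∀ i, comapF (U.incl (W i)) Ω a = comapF (U.incl (W i)) Ω b) : a = b :=
  fun_ext fun x => by
    obtain ⟨i, hi⟩ := exists_mem hW x.1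
    exact congrArg (fun c => c.1 ⟨pt (W i) x.1 hi, x.2⟩) (H i)

lemma le_iSup_im (hW : ⨆ i, W i = ⊤) (Ω : Opens U.toTop) :
    Ω ≤ ⨆ i, im (W i) (pre (U.incl (W i)) Ω) := fun x hx => by
  obtain ⟨i, hi⟩ := exists_mem hW x
  exact Opens.mem_iSup.2 ⟨i, pt (W i) x hi, hx, rfl⟩

/-- Functions on the parts of `Ω` in the sets of an open cover glue if they agree at all points. -/
lemma exists_fun (hW : ⨆ i, W i = ⊤) {Ω : Opens U.toTop}
    (a : ∀ i, (U.ofOpens (W i)).Fun (pre (U.incl (W i)) Ω))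
    (H : ∀ i j (x : U.carrier) (hx : x ∈ Ω) (hi : x ∈ W i) (hj : x ∈ W j),
      (a i).1 ⟨pt (W i) x hi, hx⟩ = (a j).1 ⟨pt (W j) x hj, hx⟩) :
    ∃ b : U.Fun Ω, ∀ i, comapF (U.incl (W i)) Ω b = a i := by
  obtain ⟨b, hb⟩ := exists_glue (unit U) (fun i => im_pre_le (W i) Ω) (le_iSup_im hW Ω)
    (fun i => toUnit _ (imF (W i) _ (a i))) fun i j => fun_ext fun x =>
      H i j x.1 (im_pre_le _ _ x.2.1) (im_le _ _ x.2.1) (im_le _ _ x.2.2)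
  refine ⟨(toUnit Ω).symm b, fun i => fun_ext fun x => ?_⟩
  let y : toOpens (im (W i) (pre (U.incl (W i)) Ω)) := ⟨x.1.1, Set.mem_image_of_mem _ x.2⟩
  exact congrArg (fun c : U.Fun (im (W i) (pre (U.incl (W i)) Ω)) => c.1 y) (hb i)

end

section
variable {ι : Type} {W : ι → Opens U.carrier}
  {D : IPVecStack.DescentData (fun i => U.incl (W i))} {Y Y' : Man} {i j k : ι} {Ω Ω' : Opens U.toTop}

/-- The sections of the glued sheaf. -/
def toGlue (Ω : Opens U.toTop) : glueSec D Ω ≃+ Sec (glueSh D) Ω := AddEquiv.refl _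

/-- The component of a section of the glued sheaf. -/
def cp (v : Sec (glueSh D) Ω) (i : ι) : Sec (dSh D i) (pre (U.incl (W i)) Ω) :=
  comp ((toGlue Ω).symm v) i

lemma cp_toGlue (s : glueSec D Ω) (i : ι) : cp (toGlue Ω s) i = comp s i := rfl

lemma cp_ext {v w : Sec (glueSh D) Ω} (h : ∀ i, cp v i = cp w i) : v = w := glueSec_ext h

lemma cp_add (v w : Sec (glueSh D) Ω) (i : ι) : cp (v + w) i = cp v i + cp w i := rfl

lemma cp_smul (a : U.Fun Ω) (v : Sec (glueSh D) Ω) (i : ι) :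
    cp (a • v) i = comapF (U.incl (W i)) Ω a • cp v i := rfl

lemma cp_res (e : Ω' ≤ Ω) (v : Sec (glueSh D) Ω) (i : ι) :
    cp (res _ e v) i = res _ (pre_mono _ e) (cp v i) := rfl

lemma agree_cp (v : Sec (glueSh D) Ω) {f₁ : Y ⟶ U.ofOpens (W i)} {f₂ : Y ⟶ U.ofOpens (W j)}
    (h : f₁ ≫ U.incl (W i) = f₂ ≫ U.incl (W j)) {Z : Opens Y.toTop}
    (h₁ : Z ≤ pre f₁ (pre (U.incl (W i)) Ω)) (h₂ : Z ≤ pre f₂ (pre (U.incl (W j)) Ω)) :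
    Agree D h (cp v i) (cp v j) Z h₁ h₂ := agree_comp _ h h₁ h₂

variable (D) in
/-- The `*`-structure of the glued sheaf, given on components. -/
def glueStar : glueSh D ⟶ (conj U).obj (glueSh D) :=
  mkHom (fun Ω v => toConj _ Ω (toGlue Ω (mkSec (fun i => st (dObj D i).star (cp v i))
      fun Y i j f₁ f₂ h Z h₁ h₂ => (agree_cp v h h₁ h₂).star)))
    (fun Ω v w => by
      rw [← map_add]
      refine congrArg _ (cp_ext fun i => ?_)
      rw [cp_add, cp_toGlue, cp_toGlue, cp_toGlue, comp_mkSec, comp_mkSec, comp_mkSec, cp_add,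
        st_add])
    (fun Ω a v => by
      rw [← conjF_conjF Ω a, ← toConj_smul, conjF_conjF]
      refine congrArg _ (cp_ext fun i => ?_)
      rw [cp_smul, cp_toGlue, cp_toGlue, comp_mkSec, comp_mkSec, cp_smul, st_smul, comapF_conjF])
    (fun Ω Ω' e v => by
      rw [res_toConj]
      refine congrArg _ (cp_ext fun i => ?_)
      rw [cp_res, cp_toGlue, cp_toGlue, comp_mkSec, comp_mkSec, cp_res, res_st])

lemma cp_star (v : Sec (glueSh D) Ω) (i : ι) :
    cp (st (glueStar D) v) i = st (dObj D i).star (cp v i) := rfl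

/-- The pairings of the components agree on overlaps, since the gluing morphisms preserve the
pairings, and hence glue to a function. -/
lemma exists_pairing (hW : ⨆ i, W i = ⊤) (v w : Sec (glueSh D) Ω) :
    ∃ b : U.Fun Ω, ∀ i, comapF (U.incl (W i)) Ω b = ip (dObj D i).pairing (cp v i) (cp w i) := by
  refine exists_fun hW _ fun i j x hx hi hj => ?_
  let q := U.incl (W i ⊓ W j)
  let f₁ := codRestrict q (W i) fun y => y.2.1
  let f₂ := codRestrict q (W j) fun y => y.2.2
  have h : f₁ ≫ U.incl (W i) = f₂ ≫ U.incl (W j) := rfl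
  have e := (agree_cp v h (Z := pre q Ω) le_rfl le_rfl).pairing (agree_cp w h le_rfl le_rfl)
  exact congrArg (fun c => c.1 ⟨pt _ x ⟨hi, hj⟩, hx⟩) e

/-- The pairing of two sections of the glued sheaf. -/
def glueIp (hW : ⨆ i, W i = ⊤) (v w : Sec (glueSh D) Ω) : U.Fun Ω :=
  (exists_pairing hW v w).choose

lemma comapF_glueIp (hW : ⨆ i, W i = ⊤) (v w : Sec (glueSh D) Ω) (i : ι) :
    comapF (U.incl (W i)) Ω (glueIp hW v w) = ip (dObj D i).pairing (cp v i) (cp w i) :=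
  (exists_pairing hW v w).choose_spec i

variable (D) in
/-- The pairing of the glued sheaf. -/
def gluePairing (hW : ⨆ i, W i = ⊤) : tensor (glueSh D) (glueSh D) ⟶ unit U :=
  lift
    { toFun Ω v w := toUnit Ω (glueIp hW v w)
      add_left Ω v v' w := by
        rw [← map_add]
        refine congrArg _ (fun_ext_cover hW fun i => ?_)
        rw [map_add, comapF_glueIp, comapF_glueIp, comapF_glueIp, cp_add, ip_add_left]
      add_right Ω v w w' := by
        rw [← map_add]
        refine congrArg _ (fun_ext_cover hW fun i => ?_)
        rw [map_add, comapF_glueIp, comapF_glueIp, comapF_glueIp, cp_add, ip_add_right]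
      smul_left Ω a v w := by
        rw [smul_toUnit]
        refine congrArg _ (fun_ext_cover hW fun i => ?_)
        rw [map_mul, comapF_glueIp, comapF_glueIp, cp_smul, ip_smul_left]
      smul_right Ω a v w := by
        rw [smul_toUnit]
        refine congrArg _ (fun_ext_cover hW fun i => ?_)
        rw [map_mul, comapF_glueIp, comapF_glueIp, cp_smul, ip_smul_right]
      res_fun Ω Ω' e v w := by
        rw [res_toUnit]
        refine congrArg _ (fun_ext_cover hW fun i => ?_)
        rw [← resF_comapF, comapF_glueIp, comapF_glueIp, cp_res, cp_res, res_ip] }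

lemma comapF_ip (hW : ⨆ i, W i = ⊤) (v w : Sec (glueSh D) Ω) (i : ι) :
    comapF (U.incl (W i)) Ω (ip (gluePairing D hW) v w) =
      ip (dObj D i).pairing (cp v i) (cp w i) := by
  rw [ip, gluePairing, lift_tmul, AddEquiv.symm_apply_apply, comapF_glueIp]

variable (D) in
/-- The object obtained by gluing a descent datum. -/
abbrev glueObj (hW : ⨆ i, W i = ⊤) : IPVec U where
  sheaf := glueSh D
  star := glueStar D
  star_star := hom_ext fun Ω v => st_conjConj.2 (cp_ext fun i => by
    rw [cp_star, cp_star]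
    exact st_conjConj.1 (app_comm (dObj D i).star_star _))
  pairing := gluePairing D hW
  symm := tensor_ext fun Ω v w => ip_braiding.2 (fun_ext_cover hW fun i => by
    rw [comapF_ip, comapF_ip]
    exact ip_braiding.1 (app_comm (dObj D i).symm _))
  star_pairing := tensor_ext fun Ω v w => ip_star.2 (fun_ext_cover hW fun i => by
    rw [comapF_ip, comapF_conjF, comapF_ip, cp_star, cp_star]
    exact ip_star.1 (app_comm (dObj D i).star_pairing _))

/-! ### The restrictions of the glued sheaf -/

variable (D) in
/-- The canonical morphism from the pullback of the glued sheaf to the given sheaf on `W i`, which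
sends a section to its component. -/
def glueHom (i : ι) : (pullback (U.incl (W i))).obj (glueSh D) ⟶ dSh D i :=
  extend (U.incl (W i)) (mkHom (fun Ω v => toPf _ (dSh D i) Ω (cp v i))
    (fun Ω v w => by rw [cp_add, map_add])
    (fun Ω a v => by rw [cp_smul, toPf_smul])
    (fun Ω Ω' e v => by rw [cp_res, res_toPf]))

lemma glueHom_eta (i : ι) (v : Sec (glueSh D) Ω) :
    app (glueHom D i) _ (eta (U.incl (W i)) v) = cp v i := by
  rw [glueHom, extend_eta, app_mkHom, AddEquiv.symm_apply_apply]

lemma glueHom_pb (i : ι) (v : Sec (glueSh D) Ω) {Z} (h : Z ≤ pre (U.incl (W i)) Ω) :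
    app (glueHom D i) _ (pb (U.incl (W i)) v Z h) = res _ h (cp v i) := by
  rw [pb, app_res, glueHom_eta]

/-- On an open subset `X` of `W j`, a section is determined by one that it agrees with. -/
lemma Agree.unique {X : Opens (U.ofOpens (W j)).toTop}
    {f₁ : (U.ofOpens (W j)).ofOpens (toOpens X) ⟶ U.ofOpens (W i)}
    {h : f₁ ≫ U.incl (W i) = (U.ofOpens (W j)).incl (toOpens X) ≫ U.incl (W j)}
    {Ω₁} {s : Sec (dSh D i) Ω₁} {t t' : Sec (dSh D j) X} {h₁ : ⊤ ≤ pre f₁ Ω₁}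
    {h₂ : ⊤ ≤ pre ((U.ofOpens (W j)).incl (toOpens X)) X}
    (H : Agree D h s t ⊤ h₁ h₂) (H' : Agree D h s t' ⊤ h₁ h₂) : t = t' := by
  have := pb_incl_inj (toOpens X) h₂ h₂ (Eq.trans (Eq.symm H) H') (X := X)
    (fun x hx => ⟨pt (toOpens X) x hx, trivial, rfl⟩) le_rfl le_rfl
  rwa [res_refl, res_refl] at this

/-- Over an open subset of `W i` a section of the glued sheaf is determined by its component at `i`:
the other components are images of it under gluing morphisms. -/
lemma cp_injective (hΩ : Ω ≤ W i) {v w : Sec (glueSh D) Ω} (H : cp v i = cp w i) : v = w := by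
  refine cp_ext fun j => ?_
  let X : Opens (U.ofOpens (W j)).toTop := pre (U.incl (W j)) Ω
  let f₂ := (U.ofOpens (W j)).incl (toOpens X)
  let f₁ := codRestrict (f₂ ≫ U.incl (W j)) (W i) fun y => hΩ y.2
  have h : f₁ ≫ U.incl (W i) = f₂ ≫ U.incl (W j) := rfl
  have h₂ : ⊤ ≤ pre f₂ X := fun y _ => y.2
  have h₁ : ⊤ ≤ pre f₁ (pre (U.incl (W i)) Ω) := fun y _ => y.2
  have A := agree_cp v h h₁ h₂
  have B := agree_cp w h h₁ h₂
  rw [H] at A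
  exact Agree.unique A B

/-- A section over an open subset `Ω` of `W i` is carried to `W j` by the gluing morphism on the part
of `Ω` in `W j`, which lies over both. -/
lemma exists_agree (hΩ : Ω ≤ W i) (a : Sec (dSh D i) (pre (U.incl (W i)) Ω)) (j : ι) :
    ∃ t : Sec (dSh D j) (pre (U.incl (W j)) Ω), ∀ (Y : Man) (g₁ : Y ⟶ U.ofOpens (W i))
      (g₂ : Y ⟶ U.ofOpens (W j)) (h : g₁ ≫ U.incl (W i) = g₂ ≫ U.incl (W j))
      (h₁ : ⊤ ≤ pre g₁ (pre (U.incl (W i)) Ω)) (h₂ : ⊤ ≤ pre g₂ (pre (U.incl (W j)) Ω)),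
      Agree D h a t ⊤ h₁ h₂ := by
  let X : Opens (U.ofOpens (W j)).toTop := pre (U.incl (W j)) Ω
  let f₂ := (U.ofOpens (W j)).incl (toOpens X)
  let f₁ := codRestrict (f₂ ≫ U.incl (W j)) (W i) fun y => hΩ y.2
  have h : f₁ ≫ U.incl (W i) = f₂ ≫ U.incl (W j) := rfl
  have h₂ : ⊤ ≤ pre f₂ X := fun y _ => y.2
  have h₁ : ⊤ ≤ pre f₁ (pre (U.incl (W i)) Ω) := fun y _ => y.2
  obtain ⟨t, ht⟩ := pb_incl_surjective (toOpens X) (app (dHom D f₁ f₂ h) ⊤ (pb f₁ a ⊤ h₁))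
  have hX : X ≤ im (toOpens X) ⊤ := fun x hx => ⟨pt (toOpens X) x hx, trivial, rfl⟩
  have A : Agree D h a (res _ hX t) ⊤ h₁ h₂ := by
    rw [Agree, pb_res]
    exact ht.symm
  refine ⟨res _ hX t, fun Y g₁ g₂ h' h₁' h₂' => ?_⟩
  -- `g₁` and `g₂` factor through `X`, where agreement holds by construction
  let l : Y ⟶ (U.ofOpens (W j)).ofOpens (toOpens X) := codRestrict g₂ (toOpens X) fun y => h₂' trivial
  obtain rfl : l ≫ f₁ = g₁ := incl_cancel h'.symm
  exact A.pull l h' (Z' := ⊤) le_top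

/-- Over an open subset of `W i` a section of the given sheaf is the component of a section of the
glued sheaf. The components at `j` and `k` agree since both agree with that at `i`; this is the
cocycle condition. -/
lemma cp_surjective (hΩ : Ω ≤ W i) (a : Sec (dSh D i) (pre (U.incl (W i)) Ω)) :
    ∃ v : Sec (glueSh D) Ω, cp v i = a := by
  choose t ht using exists_agree hΩ a
  refine ⟨toGlue Ω (mkSec t ?_), ?_⟩
  · intro Y j k f₁ f₂ h Z h₁ h₂
    let p := Y.incl (toOpens Z)
    let f₀ : Y.ofOpens (toOpens Z) ⟶ U.ofOpens (W i) :=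
      codRestrict ((p ≫ f₁) ≫ U.incl (W j)) (W i) fun y => hΩ (h₁ y.2)
    have e₁ : f₀ ≫ U.incl (W i) = (p ≫ f₁) ≫ U.incl (W j) := rfl
    have e : (p ≫ f₁) ≫ U.incl (W j) = (p ≫ f₂) ≫ U.incl (W k) := congrArg (p ≫ ·) h
    have m₀ : ⊤ ≤ pre f₀ (pre (U.incl (W i)) Ω) := fun y _ => h₁ y.2
    have m₁ : ⊤ ≤ pre (p ≫ f₁) (pre (U.incl (W j)) Ω) := fun y _ => h₁ y.2
    have m₂ : ⊤ ≤ pre (p ≫ f₂) (pre (U.incl (W k)) Ω) := fun y _ => h₂ y.2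
    have A := ht j _ f₀ (p ≫ f₁) e₁ m₀ m₁
    have B := ht k _ f₀ (p ≫ f₂) (e₁.trans e) m₀ m₂
    exact Agree.of_incl (A.symm.trans B)
  · rw [cp_toGlue, comp_mkSec]
    let X : Opens (U.ofOpens (W i)).toTop := pre (U.incl (W i)) Ω
    have hX : ⊤ ≤ pre ((U.ofOpens (W i)).incl (toOpens X)) X := fun y _ => y.2
    exact Agree.unique (ht i _ _ _ rfl hX hX) (Agree.refl hX)

lemma glueHom_bijective (i : ι) (Z : Opens (U.ofOpens (W i)).toTop) :
    Function.Bijective (app (glueHom D i) Z) := by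
  constructor
  · intro a b H
    obtain ⟨v, rfl⟩ := pb_incl_surjective (W i) a
    obtain ⟨w, rfl⟩ := pb_incl_surjective (W i) b
    rw [glueHom_pb, glueHom_pb] at H
    have H' := congrArg (res _ (pre_im (W i) Z).le) H
    rw [res_res, res_res, res_refl, res_refl] at H'
    rw [cp_injective (im_le (W i) Z) H']
  · intro a
    obtain ⟨v, hv⟩ := cp_surjective (im_le (W i) Z) (res _ (pre_im (W i) Z).le a)
    refine ⟨pb (U.incl (W i)) v Z (pre_im (W i) Z).ge, ?_⟩
    rw [glueHom_pb, hv, res_res, res_refl]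

end

/-! ### Descent data of restrictions -/

/-- Giving this proof a name makes all the coherence isomorphisms below literally the same terms. -/
lemma toLoc_comp {f : U' ⟶ U''} {g : U ⟶ U'} {q : U ⟶ U''} (hq : g ≫ f = q) :
    f.op.toLoc ≫ g.op.toLoc = q.op.toLoc :=
  congrArg (fun q => q.op.toLoc) hq

/-- The coherence isomorphism of `IPVecStack` for a composition, in the direction that composes
pullbacks. -/
def stackCompHom (f : U' ⟶ U'') (g : U ⟶ U') (q : U ⟶ U'') (hq : g ≫ f = q) (X : IPVec U'') :
    IPVec.pullbackObj g (IPVec.pullbackObj f X) ⟶ IPVec.pullbackObj q X :=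
  (IPVecStack.mapComp' f.op.toLoc g.op.toLoc q.op.toLoc (toLoc_comp hq)).inv.toNatTrans.app X

/-- The coherence isomorphism of `IPVecStack` for a composition, in the direction that splits
pullbacks. -/
def stackCompInv (f : U' ⟶ U'') (g : U ⟶ U') (q : U ⟶ U'') (hq : g ≫ f = q) (X : IPVec U'') :
    IPVec.pullbackObj q X ⟶ IPVec.pullbackObj g (IPVec.pullbackObj f X) :=
  (IPVecStack.mapComp' f.op.toLoc g.op.toLoc q.op.toLoc (toLoc_comp hq)).hom.toNatTrans.app X

lemma stackCompHom_hom (f : U' ⟶ U'') (g : U ⟶ U') (X : IPVec U'') :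
    (stackCompHom f g (g ≫ f) rfl X).hom = compHom g f X.sheaf := by
  rw [stackCompHom, show IPVecStack.mapComp' f.op.toLoc g.op.toLoc (g ≫ f).op.toLoc _ =
    IPVecStack.mapComp f.op.toLoc g.op.toLoc from Pseudofunctor.mapComp'_eq_mapComp _ _ _]
  rfl

lemma stackCompInv_hom (f : U' ⟶ U'') (g : U ⟶ U') (X : IPVec U'') :
    (stackCompInv f g (g ≫ f) rfl X).hom = compInv g f X.sheaf := by
  rw [stackCompInv, show IPVecStack.mapComp' f.op.toLoc g.op.toLoc (g ≫ f).op.toLoc _ =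
    IPVecStack.mapComp f.op.toLoc g.op.toLoc from Pseudofunctor.mapComp'_eq_mapComp _ _ _]
  rfl

section
variable (f : U' ⟶ U'') (g : U ⟶ U') (q : U ⟶ U'') (hq : g ≫ f = q) (X : IPVec U'')
  {Ω : Opens U''.toTop} (v : Sec X.sheaf Ω) {Z' : Opens U'.toTop} (h' : Z' ≤ pre f Ω)
  {Z : Opens U.toTop} (hZ : Z ≤ pre g Z') (hZ' : Z ≤ pre q Ω)

/-- On sections the coherence isomorphism identifies the pullback in two steps with the pullback
along the composite. -/
lemma stackCompHom_pb :
    app (V := (pullback g).obj ((pullback f).obj X.sheaf)) (W := (pullback q).obj X.sheaf)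
      (stackCompHom f g q hq X).hom Z (pb g (pb f v Z' h') Z hZ) = pb q v Z hZ' := by
  subst hq
  rw [stackCompHom_hom]
  exact compHom_pb g f v h' hZ

lemma stackCompInv_pb :
    app (V := (pullback q).obj X.sheaf) (W := (pullback g).obj ((pullback f).obj X.sheaf))
      (stackCompInv f g q hq X).hom Z (pb q v Z hZ') = pb g (pb f v Z' h') Z hZ := by
  subst hq
  rw [stackCompInv_hom]
  exact compInv_pb g f v h' hZ

end

section
variable {ι : Type} {W : ι → Opens U.carrier}
  {D : IPVecStack.DescentData (fun i => U.incl (W i))} {Y Y' : Man} {i j k : ι} {Ω Ω' : Opens U.toTop}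

variable (W) in
/-- The descent datum given by the restrictions of an object. -/
def restrData (X : IPVec U) : IPVecStack.DescentData (fun i => U.incl (W i)) :=
  (IPVecStack.toDescentData (fun i => U.incl (W i))).obj X

/-- Composition in the fibre of `IPVecStack` over `Y` is composition of morphisms of sheaves. -/
lemma stack_comp_hom {Y : Man} {A B C : IPVec Y} {m : A ⟶ C} {a a' : A ⟶ B} {b b' : B ⟶ C}
    (H : m = @CategoryStruct.comp (IPVecStack.obj ⟨op Y⟩) _ A B C a b) (ha : a = a')
    (hb : b = b') : m.hom = a'.hom ≫ b'.hom := by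
  subst H ha hb
  rfl

/-- The gluing morphisms of the canonical descent datum of an object are composites of coherence
isomorphisms. This is stated for a general pseudofunctor, as a comparison by definition would
evaluate the coherence isomorphisms of `IPVecStack`. -/
lemma toDescentData_hom {C : Type*} [Category C] (F : Pseudofunctor (LocallyDiscrete Cᵒᵖ) Cat)
    {κ : Type*} {S : C} {X : κ → C} (f : ∀ i, X i ⟶ S) (M : F.obj (.mk (op S))) {Y : C} (q : Y ⟶ S)
    (i₁ i₂ : κ) (f₁ : Y ⟶ X i₁) (f₂ : Y ⟶ X i₂) (hf₁ : f₁ ≫ f i₁ = q) (hf₂ : f₂ ≫ f i₂ = q)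
    (h₁ h₂) :
    ((F.toDescentData f).obj M).hom q f₁ f₂ hf₁ hf₂ =
      (F.mapComp' (f i₁).op.toLoc f₁.op.toLoc q.op.toLoc h₁).inv.toNatTrans.app M ≫
        (F.mapComp' (f i₂).op.toLoc f₂.op.toLoc q.op.toLoc h₂).hom.toNatTrans.app M := rfl

lemma toDescentData_hom_hom {κ : Type} {X : κ → Man} (f : ∀ i, X i ⟶ U) (M : IPVec U)
    (q : Y ⟶ U) (i j : κ) (f₁ : Y ⟶ X i) (f₂ : Y ⟶ X j) (h₁ : f₁ ≫ f i = q) (h₂ : f₂ ≫ f j = q) :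
    IPVec.Hom.hom (X := IPVec.pullbackObj f₁ (IPVec.pullbackObj (f i) M))
        (Y := IPVec.pullbackObj f₂ (IPVec.pullbackObj (f j) M))
        (((IPVecStack.toDescentData f).obj M).hom q f₁ f₂ h₁ h₂) =
      (stackCompHom (f i) f₁ q h₁ M).hom ≫ (stackCompInv (f j) f₂ q h₂ M).hom :=
  stack_comp_hom (A := IPVec.pullbackObj f₁ (IPVec.pullbackObj (f i) M))
    (B := IPVec.pullbackObj q M) (C := IPVec.pullbackObj f₂ (IPVec.pullbackObj (f j) M))
    (toDescentData_hom IPVecStack f M q i j f₁ f₂ h₁ h₂ (toLoc_comp h₁) (toLoc_comp h₂))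
    -- the definitions are expanded once, so that both sides become literally equal
    (stackCompHom.eq_def (f i) f₁ q h₁ M).symm (stackCompInv.eq_def (f j) f₂ q h₂ M).symm

lemma app_eq_of_comp {V V' V'' : Sh U} {m : V ⟶ V''} {a : V ⟶ V'} {b : V' ⟶ V''}
    (H : m = a ≫ b) {s : Sec V Ω} {t : Sec V' Ω} {u : Sec V'' Ω} (ha : app a Ω s = t)
    (hb : app b Ω t = u) : app m Ω s = u := by
  rw [H, app_comp, ha, hb]

section
variable {U₁ U₂ : Man} (f : U₁ ⟶ U) (g : U₂ ⟶ U) (f₁ : Y ⟶ U₁) (f₂ : Y ⟶ U₂) (q : Y ⟶ U)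
  (h₁ : f₁ ≫ f = q) (h₂ : f₂ ≫ g = q) (M : IPVec U)

/-- The canonical morphism between the two pullbacks along a commutative square with diagonal `q`.
It is composed of the coherence isomorphisms of `IPVecStack`. -/
def squareHom : (pullback f₁).obj ((pullback f).obj M.sheaf) ⟶
    (pullback f₂).obj ((pullback g).obj M.sheaf) :=
  (stackCompHom f f₁ q h₁ M).hom ≫ (stackCompInv g f₂ q h₂ M).hom

/-- The canonical morphism sends the pullback of a section in two steps to its pullback in the other
two steps. -/
lemma squareHom_pb (v : Sec M.sheaf Ω) {Z₁ Z₂} {Z : Opens Y.toTop} (k₁ : Z₁ ≤ pre f Ω)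
    (k₂ : Z₂ ≤ pre g Ω) (k₁' : Z ≤ pre f₁ Z₁) (k₂' : Z ≤ pre f₂ Z₂) :
    app (squareHom f g f₁ f₂ q h₁ h₂ M) Z (pb f₁ (pb f v Z₁ k₁) Z k₁') =
      pb f₂ (pb g v Z₂ k₂) Z k₂' := by
  have hZ : Z ≤ pre q Ω := h₁ ▸ k₁'.trans (pre_mono f₁ k₁)
  exact app_eq_of_comp (squareHom.eq_def f g f₁ f₂ q h₁ h₂ M)
    (stackCompHom_pb f f₁ q h₁ M v k₁ k₁' hZ) (stackCompInv_pb g f₂ q h₂ M v k₂ k₂' hZ)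

end

lemma toDescentData_hom_eq {κ : Type} {X : κ → Man} (f : ∀ i, X i ⟶ U) (M : IPVec U) (i j : κ)
    (f₁ : Y ⟶ X i) (f₂ : Y ⟶ X j) (q : Y ⟶ U) (h₁ : f₁ ≫ f i = q) (h₂ : f₂ ≫ f j = q) :
    IPVec.Hom.hom (X := IPVec.pullbackObj f₁ (IPVec.pullbackObj (f i) M))
        (Y := IPVec.pullbackObj f₂ (IPVec.pullbackObj (f j) M))
        (((IPVecStack.toDescentData f).obj M).hom q f₁ f₂ h₁ h₂) =
      squareHom (f i) (f j) f₁ f₂ q h₁ h₂ M :=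
  (toDescentData_hom_hom f M q i j f₁ f₂ h₁ h₂).trans
    (squareHom.eq_def (f i) (f j) f₁ f₂ q h₁ h₂ M).symm

/-- The gluing morphism does not depend on how the composite to `U` is written. -/
lemma dHom_eq (f₁ : Y ⟶ U.ofOpens (W i)) (f₂ : Y ⟶ U.ofOpens (W j)) (q : Y ⟶ U)
    (h₁ : f₁ ≫ U.incl (W i) = q) (h₂ : f₂ ≫ U.incl (W j) = q) :
    dHom D f₁ f₂ (h₁.trans h₂.symm) = IPVec.Hom.hom (X := IPVec.pullbackObj f₁ (dObj D i))
      (Y := IPVec.pullbackObj f₂ (dObj D j)) (D.hom q f₁ f₂ h₁ h₂) := by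
  subst h₁
  rfl

lemma dHom_restrData (X : IPVec U) (f₁ : Y ⟶ U.ofOpens (W i)) (f₂ : Y ⟶ U.ofOpens (W j)) (q : Y ⟶ U)
    (h₁ : f₁ ≫ U.incl (W i) = q) (h₂ : f₂ ≫ U.incl (W j) = q) :
    dHom (restrData W X) f₁ f₂ (h₁.trans h₂.symm) =
      squareHom (U.incl (W i)) (U.incl (W j)) f₁ f₂ q h₁ h₂ X :=
  (dHom_eq (D := (IPVecStack.toDescentData (fun i => U.incl (W i))).obj X) f₁ f₂ q h₁ h₂).trans
    (toDescentData_hom_eq (fun i => U.incl (W i)) X i j f₁ f₂ q h₁ h₂)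

/-- The gluing morphisms of the restrictions of an object. -/
def restrHom (X : IPVec U) (f₁ : Y ⟶ U.ofOpens (W i)) (f₂ : Y ⟶ U.ofOpens (W j))
    (h : f₁ ≫ U.incl (W i) = f₂ ≫ U.incl (W j)) :
    (pullback f₁).obj ((pullback (U.incl (W i))).obj X.sheaf) ⟶
      (pullback f₂).obj ((pullback (U.incl (W j))).obj X.sheaf) :=
  dHom (restrData W X) f₁ f₂ h

lemma restrHom_eq (X : IPVec U) (f₁ : Y ⟶ U.ofOpens (W i)) (f₂ : Y ⟶ U.ofOpens (W j))
    (h : f₁ ≫ U.incl (W i) = f₂ ≫ U.incl (W j)) :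
    restrHom X f₁ f₂ h =
      squareHom (U.incl (W i)) (U.incl (W j)) f₁ f₂ (f₁ ≫ U.incl (W i)) rfl h.symm X :=
  dHom_restrData X f₁ f₂ (f₁ ≫ U.incl (W i)) rfl h.symm

lemma restrHom_pb (X : IPVec U) {f₁ : Y ⟶ U.ofOpens (W i)} {f₂ : Y ⟶ U.ofOpens (W j)}
    (h : f₁ ≫ U.incl (W i) = f₂ ≫ U.incl (W j)) (v : Sec X.sheaf Ω) {Z₁ Z₂} {Z : Opens Y.toTop}
    (h₁ : Z₁ ≤ pre (U.incl (W i)) Ω) (h₂ : Z₂ ≤ pre (U.incl (W j)) Ω) (h₁' : Z ≤ pre f₁ Z₁)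
    (h₂' : Z ≤ pre f₂ Z₂) :
    app (restrHom X f₁ f₂ h) Z (pb f₁ (pb (U.incl (W i)) v Z₁ h₁) Z h₁') =
      pb f₂ (pb (U.incl (W j)) v Z₂ h₂) Z h₂' :=
  (app_comm (restrHom_eq X f₁ f₂ h) _).trans
    (squareHom_pb (U.incl (W i)) (U.incl (W j)) f₁ f₂ (f₁ ≫ U.incl (W i)) rfl h.symm X v h₁ h₂
      h₁' h₂')

/-! ### Essential surjectivity -/

/-- A morphism of sheaves of modules that is bijective on sections is an isomorphism. -/
def isoOfBijective {V V' : Sh U} (f : V ⟶ V') (H : ∀ Ω, Function.Bijective (app f Ω)) : V ≅ V' :=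
  let e := fun Ω => LinearEquiv.ofBijective (app f Ω) (H Ω)
  have he : ∀ Ω v, app f Ω ((e Ω).symm v) = v := fun Ω v => (e Ω).apply_symm_apply v
  have he' : ∀ Ω v, (e Ω).symm (app f Ω v) = v := fun Ω v => (e Ω).symm_apply_apply v
  Iso.mk (C := Sh U) (X := V) (Y := V') f
    (mkHom (fun Ω v => (e Ω).symm v) (fun Ω v w => map_add _ _ _) (fun Ω a v => map_smul _ _ _)
      (fun Ω Ω' i v => (H Ω').1 (by rw [he, app_res, he])))
    (hom_ext he') (hom_ext he)

variable (D) in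
/-- The restriction of the glued object to `W i` is the given object. -/
def glueIso (hW : ⨆ i, W i = ⊤) (i : ι) :
    IPVec.pullbackObj (U.incl (W i)) (glueObj D hW) ≅ dObj D i :=
  IPVec.isoMk (X := IPVec.pullbackObj (U.incl (W i)) (glueObj D hW)) (Y := dObj D i)
    (isoOfBijective (glueHom D i) (glueHom_bijective i))
    (pullback_ext (U.incl (W i)) fun Ω v => st_conj_map.2 (by
      change app (glueHom D i) _ (st (pullbackStar _ (glueStar D)) _) =
        st _ (app (glueHom D i) _ _)
      rw [st_eta, glueHom_eta, glueHom_eta, cp_star]))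
    (tensor_pullback_ext (U.incl (W i)) fun Ω v w => ip_map.2 (by
      change ip _ (app (glueHom D i) _ _) (app (glueHom D i) _ _) =
        ip (pullbackPairing _ (gluePairing D hW)) _ _
      rw [ip_eta, glueHom_eta, glueHom_eta, comapF_ip]))

variable (D) in
lemma glueHom_comm (hW : ⨆ i, W i = ⊤) (f₁ : Y ⟶ U.ofOpens (W i)) (f₂ : Y ⟶ U.ofOpens (W j))
    (h : f₁ ≫ U.incl (W i) = f₂ ≫ U.incl (W j)) :
    (pullback f₁).map (glueHom D i) ≫ dHom D f₁ f₂ h =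
      restrHom (glueObj D hW) f₁ f₂ h ≫ (pullback f₂).map (glueHom D j) := by
  refine pullback_ext₂ f₁ (U.incl (W i)) fun Ω v => ?_
  have hZ := (pre_eq_of_comp h Ω).le
  rw [app_comp, app_comp, pullback_map_eta, glueHom_eta, eta_eq_pb f₁, eta_eq_pb f₁,
    eta_eq_pb (U.incl (W i)), restrHom_pb (glueObj D hW) h v le_rfl le_rfl le_rfl hZ, map_pb,
    ← eta_eq_pb (U.incl (W j)), glueHom_eta]
  exact agree_cp v h le_rfl hZ

variable (D) in
/-- The descent datum of the glued object is the given one. -/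
def glueDataIso (hW : ⨆ i, W i = ⊤) : restrData W (glueObj D hW) ≅ D :=
  Pseudofunctor.DescentData.isoMk (glueIso D hW) (by
    intro Y q i j f₁ f₂ hf₁ hf₂
    subst hf₁
    exact IPVec.hom_ext (glueHom_comm D hW f₁ f₂ hf₂.symm))

/-! ### Gluing of morphisms -/

/-- Sections with the same restriction to all sets of an open cover are equal. -/
lemma incl_ext (hW : ⨆ i, W i = ⊤) {V : Sh U} {v w : Sec V Ω}
    (H : ∀ i, eta (U.incl (W i)) v = eta (U.incl (W i)) w) : v = w := by
  refine sec_ext V (fun i => im_pre_le (W i) Ω) (le_iSup_im hW Ω) fun i => ?_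
  have := H i
  rw [eta_eq_pb, eta_eq_pb] at this
  exact pb_incl_inj (W i) _ _ this le_rfl _ _

lemma dHom_comm {D₁ D₂ : IPVecStack.DescentData (fun i => U.incl (W i))} (φ : D₁ ⟶ D₂)
    (f₁ : Y ⟶ U.ofOpens (W i)) (f₂ : Y ⟶ U.ofOpens (W j))
    (h : f₁ ≫ U.incl (W i) = f₂ ≫ U.incl (W j)) :
    (pullback f₁).map (IPVec.Hom.hom (φ.hom i)) ≫ dHom D₂ f₁ f₂ h =
      dHom D₁ f₁ f₂ h ≫ (pullback f₂).map (IPVec.Hom.hom (φ.hom j)) :=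
  congrArg IPVec.Hom.hom (φ.comm (f₁ ≫ U.incl (W i)) f₁ f₂ rfl h.symm)

section
variable {X X' : IPVec U} (φ : restrData W X ⟶ restrData W X')

/-- The components of a morphism of descent data. -/
def compHomSh (i : ι) :
    (pullback (U.incl (W i))).obj X.sheaf ⟶ (pullback (U.incl (W i))).obj X'.sheaf :=
  IPVec.Hom.hom (φ.hom i)

lemma compHomSh_comm (f₁ : Y ⟶ U.ofOpens (W i)) (f₂ : Y ⟶ U.ofOpens (W j))
    (h : f₁ ≫ U.incl (W i) = f₂ ≫ U.incl (W j)) :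
    (pullback f₁).map (compHomSh φ i) ≫ restrHom X' f₁ f₂ h =
      restrHom X f₁ f₂ h ≫ (pullback f₂).map (compHomSh φ j) :=
  dHom_comm φ f₁ f₂ h

/-- The images of the restrictions of a section under the components of a morphism of descent data
agree on overlaps, and hence glue. -/
lemma exists_image (hW : ⨆ i, W i = ⊤) (v : Sec X.sheaf Ω) :
    ∃ w : Sec X'.sheaf Ω, ∀ i, app (compHomSh φ i) _ (eta (U.incl (W i)) v) =
      eta (U.incl (W i)) w := by
  have key := fun i => pb_incl_surjective (W i) (app (compHomSh φ i) _ (eta (U.incl (W i)) v))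
  choose w hw using key
  obtain ⟨w', hw'⟩ := exists_glue X'.sheaf (fun i => im_pre_le (W i) Ω) (le_iSup_im hW Ω) w
    (fun i j => by
      -- the part of `Ω` in `W i` and `W j`, as a manifold over both
      let B : Opens U.toTop := im (W i) (pre (U.incl (W i)) Ω) ⊓ im (W j) (pre (U.incl (W j)) Ω)
      let p := U.incl (toOpens B)
      let f₁ := codRestrict p (W i) fun y => im_le _ _ y.2.1
      let f₂ := codRestrict p (W j) fun y => im_le _ _ y.2.2
      have h : f₁ ≫ U.incl (W i) = f₂ ≫ U.incl (W j) := rfl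
      have h₁ : ⊤ ≤ pre f₁ (pre (U.incl (W i)) Ω) := fun y _ => im_pre_le (W i) _ y.2.1
      have h₂ : ⊤ ≤ pre f₂ (pre (U.incl (W j)) Ω) := fun y _ => im_pre_le (W i) _ y.2.1
      have h₃ : ⊤ ≤ pre f₂ (pre (U.incl (W j)) (im (W i) (pre (U.incl (W i)) Ω))) :=
        fun y _ => y.2.1
      have e := app_comm (compHomSh_comm φ f₁ f₂ h) (pb f₁ (eta (U.incl (W i)) v) ⊤ h₁)
      rw [app_comp, app_comp, map_pb, ← hw i, restrHom_pb X' h (w i) _ le_rfl h₁ h₃,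
        eta_eq_pb, restrHom_pb X h v le_rfl le_rfl h₁ h₂, map_pb, ← eta_eq_pb _ v, ← hw j] at e
      -- pass from the pullbacks in two steps to the pullback along `p`, which is injective on sections
      have e' := congrArg (app (compHom f₂ (U.incl (W j)) _) ⊤) e
      rw [compHom_pb, compHom_pb] at e'
      exact pb_incl_inj (toOpens B) _ _ e' (fun x hx => ⟨pt (toOpens B) x hx, trivial, rfl⟩) _ _)
  refine ⟨w', fun i => ?_⟩
  rw [← hw i, ← hw' i, pb_res, eta_eq_pb]

/-- The image of a section under the morphism obtained by gluing. -/
def image (hW : ⨆ i, W i = ⊤) (v : Sec X.sheaf Ω) : Sec X'.sheaf Ω := (exists_image φ hW v).choose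

lemma eta_image (hW : ⨆ i, W i = ⊤) (v : Sec X.sheaf Ω) (i : ι) :
    eta (U.incl (W i)) (image φ hW v) = app (compHomSh φ i) _ (eta (U.incl (W i)) v) :=
  ((exists_image φ hW v).choose_spec i).symm

/-- The morphism of sheaves of modules obtained by gluing a morphism of descent data. -/
def glueMorSh (hW : ⨆ i, W i = ⊤) : X.sheaf ⟶ X'.sheaf :=
  mkHom (fun Ω v => image φ hW v)
    (fun Ω v w => incl_ext hW fun i => by
      rw [eta_add, eta_image, eta_image, eta_image, eta_add, map_add])
    (fun Ω a v => incl_ext hW fun i => by rw [eta_smul, eta_image, eta_image, eta_smul, map_smul])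
    (fun Ω Ω' e v => incl_ext hW fun i => by
      rw [← res_eta, eta_image, eta_image, ← res_eta, app_res])

lemma eta_glueMorSh (hW : ⨆ i, W i = ⊤) (v : Sec X.sheaf Ω) (i : ι) :
    eta (U.incl (W i)) (app (glueMorSh φ hW) Ω v) =
      app (compHomSh φ i) _ (eta (U.incl (W i)) v) := eta_image φ hW v i

/-- The morphism obtained by gluing a morphism of descent data. -/
def glueMor (hW : ⨆ i, W i = ⊤) : X ⟶ X' :=
  IPVec.Hom.mk (glueMorSh φ hW)
    (hom_ext fun Ω v => st_conj_map.2 (incl_ext hW fun i => by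
      rw [eta_glueMorSh, ← st_eta, ← st_eta, eta_glueMorSh]
      exact st_conj_map.1 (app_comm (IPVec.Hom.star_hom (φ.hom i)) _)))
    (tensor_ext fun Ω v w => ip_map.2 (fun_ext_cover hW fun i => by
      rw [← ip_eta, ← ip_eta, eta_glueMorSh, eta_glueMorSh]
      exact ip_map.1 (app_comm (IPVec.Hom.pairing_hom (φ.hom i)) (tmul _ _))))

lemma map_glueMor (hW : ⨆ i, W i = ⊤) :
    (IPVecStack.toDescentData (fun i => U.incl (W i))).map (X := X) (Y := X') (glueMor φ hW) = φ :=
  Pseudofunctor.DescentData.hom_ext fun i => IPVec.hom_ext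
    (pullback_ext (U.incl (W i)) fun _ v =>
      (pullback_map_eta _ (glueMorSh φ hW) v).trans (eta_glueMorSh φ hW v i))

end

end

end Man
end

theorem mainTheorem11 : Man.IsStack Man.IPVecStack := by
  intro U ι W hW
  refine @Functor.IsEquivalence.mk _ _ _ _ _ ⟨?_⟩ ⟨?_⟩ ⟨?_⟩
  -- faithful
  · intro X X' f g H
    refine Man.IPVec.hom_ext (Man.hom_ext fun Ω v => Man.incl_ext hW fun i => ?_)
    have e : (Man.pullback (U.incl (W i))).map (Man.IPVec.Hom.hom f) =
        (Man.pullback (U.incl (W i))).map (Man.IPVec.Hom.hom g) :=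
      congrArg (fun φ => Man.IPVec.Hom.hom (φ.hom i)) H
    have := Man.app_comm e (Man.eta (U.incl (W i)) v)
    rwa [Man.pullback_map_eta, Man.pullback_map_eta] at this
  -- full
  · intro X X' φ
    exact ⟨Man.glueMor φ hW, Man.map_glueMor φ hW⟩
  -- essentially surjective
  · intro D
    exact ⟨Man.glueObj D hW, ⟨Man.glueDataIso D hW⟩⟩
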